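/- Let $F$ be an infinite field containing a primitive fifth root of unity $\rho$ (so $\operatorname{char} F\neq 5$), let $\alpha,\beta\in F^\times$, and let $A=F[x,y : x^5=\alpha,\ y^5=\beta,\ yx=\rho xy]$ be the corresponding cyclic algebra of degree $5$. An element $a\in A$ is called $5$-central if $a^5$ is in the center of $A$ and $a^k$ is not in the center for $1\le k\le 4$; an $F$-subspace of $A$ is called $5$-central if all its nonzero elements are $5$-central. Let $V\subseteq A$ be a $5$-central subspace with $\dim_F V\ge 4$. Suppose that $V$ contains $x$, $y$ and some monomial $x^iy^j$ ($i,j\geq 0$) such that $x$, $y$, $x^iy^j$ are linearly independent over $F$. Then $V$ is contained in one of the following spaces: $$F[x]y+Fx,\qquad F[y]x+Fy,\qquad F[x^3y^2]x+F(x^3y^2)^i\ \text{ for some } 1\le i\le 4 .$$ Moreover, if $V$ is maximal with respect to inclusion among the $5$-central subspaces of $A$, then $\dim_F V=6$. -/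

import Mathlib

/-- The defining relations `x ^ d = α`, `y ^ d = β`, `y x = ρ x y` of a symbol algebra,
on the free algebra with generators `x = ι 0` and `y = ι 1`. -/
inductive SymbolRel {F : Type*} [Field F] (d : ℕ) (ρ α β : F) :
    FreeAlgebra F (Fin 2) → FreeAlgebra F (Fin 2) → Prop
  | x_pow : SymbolRel d ρ α β (FreeAlgebra.ι F 0 ^ d) (algebraMap F _ α)
  | y_pow : SymbolRel d ρ α β (FreeAlgebra.ι F 1 ^ d) (algebraMap F _ β)
  | y_mul_x : SymbolRel d ρ α β (FreeAlgebra.ι F 1 * FreeAlgebra.ι F 0)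
      (ρ • (FreeAlgebra.ι F 0 * FreeAlgebra.ι F 1))

/-- The cyclic (symbol) algebra
`(α, β)_{d,F} = F[x, y : x ^ d = α, y ^ d = β, y x = ρ x y]`. -/
abbrev SymbolAlgebra {F : Type*} [Field F] (d : ℕ) (ρ α β : F) : Type _ :=
  RingQuot (SymbolRel d ρ α β)

/-- The standard generator `x` of the symbol algebra. -/
noncomputable def SymbolAlgebra.x {F : Type*} [Field F] (d : ℕ) (ρ α β : F) :
    SymbolAlgebra d ρ α β :=
  RingQuot.mkAlgHom F (SymbolRel d ρ α β) (FreeAlgebra.ι F 0)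

/-- The standard generator `y` of the symbol algebra. -/
noncomputable def SymbolAlgebra.y {F : Type*} [Field F] (d : ℕ) (ρ α β : F) :
    SymbolAlgebra d ρ α β :=
  RingQuot.mkAlgHom F (SymbolRel d ρ α β) (FreeAlgebra.ι F 1)

/-- A noncentral element `a` is `d`-central if `a ^ d` is central and `a ^ k` is not central
for `1 ≤ k ≤ d - 1`. -/
def IsDCentral {A : Type*} [Ring A] (d : ℕ) (a : A) : Prop :=
  a ∉ Set.center A ∧ a ^ d ∈ Set.center A ∧
    ∀ k : ℕ, 1 ≤ k → k < d → a ^ k ∉ Set.center A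

/-- A `d`-central space: a subspace all of whose nonzero elements are `d`-central. -/
def IsDCentralSpace {F A : Type*} [Field F] [Ring A] [Algebra F A] (d : ℕ)
    (V : Submodule F A) : Prop :=
  ∀ v ∈ V, v ≠ 0 → IsDCentral d v

/-- The subspace `F[w] z + F u`. -/
noncomputable def adjoinMulAddSpan (F : Type*) {A : Type*} [Field F] [Ring A] [Algebra F A]
    (w z u : A) : Submodule F A :=
  (Subalgebra.toSubmodule (Algebra.adjoin F {w})).map (LinearMap.mulRight F z) ⊔
    Submodule.span F {u}

/-! The monomials `x ^ i y ^ j` with `i, j < 5` form a basis of the algebra, graded by `(ℤ/5)²`, and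
the center lives in degree `0`. So for every `v ∈ V` the coordinates of `v ^ 5` in nonzero degrees
vanish. Apply this to `s₁ x + s₂ y + s₃ m + s v`, where `m` is the third monomial: since `F` is
infinite, each coefficient in the `sᵢ` and `s` vanishes. Such a coefficient is a sum over words, and
all words with the same letters are multiples of one monomial. Their sum has as factor a sum of
powers of `ρ` (`qshuffle`). If, in `ℤ[ζ]` with `ζ` a complex primitive fifth root of unity, the
corresponding sum has norm `5 ^ 4`, it stays nonzero in `F`, because `char F ≠ 5`; the product of
coordinates of `v` in front of it must then vanish.

In degree `0` in `v` this restricts `m`, in degree `1` it restricts the support of `v` to a short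
list, and in degree `2` it kills products of two coordinates. A product of linear forms vanishing on
`V` has a factor vanishing on `V`, and `dim V ≥ 4` supplies a fourth monomial occurring in `V`. A
finite check (`exists_familyWorks`) then puts the support of `V` in one of the standard families, or
in the sum of the four spaces built on `w = x ^ 3 y ^ 2`.

The rest concerns a pair `z w = q w z` with `w ^ 5 = a` and `z ^ 5 = b` nonzero scalars
(`SymbolPair`). If `a` were a fifth power, three independent elements of `V ∩ F[w] z` would combine
to a nonzero nilpotent. Hence `X ^ 5 - a` is irreducible and `F[w]` is a field. Conjugation by
powers of `w` rescales `z` alone, and averaging over it shows that `g` is a monomial whenever `p(w)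
z + g(w)` has central fifth power; this separates the four spaces in the sum. Conversely, the field
property and the `q`-binomial formula make all of `F[w] z + F w ^ i` 5-central, of dimension `6`, so
a maximal `V` equals it. -/

namespace SymbolAlgebra

/-! ### Relations and `q`-commuting monomials -/

section Relations

variable {F : Type*} [Field F] {d : ℕ} {ρ α β : F}

theorem x_pow_self : x d ρ α β ^ d = algebraMap F _ α := by
  have := RingQuot.mkAlgHom_rel F (SymbolRel.x_pow (d := d) (ρ := ρ) (α := α) (β := β))
  simpa [x] using this

theorem y_pow_self : y d ρ α β ^ d = algebraMap F _ β := by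
  have := RingQuot.mkAlgHom_rel F (SymbolRel.y_pow (d := d) (ρ := ρ) (α := α) (β := β))
  simpa [y] using this

theorem y_mul_x : y d ρ α β * x d ρ α β = ρ • (x d ρ α β * y d ρ α β) := by
  have := RingQuot.mkAlgHom_rel F (SymbolRel.y_mul_x (d := d) (ρ := ρ) (α := α) (β := β))
  simpa [x, y] using this

end Relations

/-- If `y x = q x y` then `y ^ j x ^ i = q ^ (j i) x ^ i y ^ j`. -/
theorem qcomm_pow_pow {F A : Type*} [Field F] [Ring A] [Algebra F A] {q : F} {x y : A}
    (h : y * x = q • (x * y)) (i j : ℕ) : y ^ j * x ^ i = q ^ (j * i) • (x ^ i * y ^ j) := by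
  have h1 : ∀ i : ℕ, y * x ^ i = q ^ i • (x ^ i * y) := by
    intro i
    induction i with
    | zero => simp
    | succ i ih =>
      rw [pow_succ, ← mul_assoc, ih, smul_mul_assoc, mul_assoc, h, mul_smul_comm, smul_smul,
        ← pow_succ, mul_assoc]
  induction j with
  | zero => simp
  | succ j ih =>
    rw [pow_succ', mul_assoc, ih, mul_smul_comm, ← mul_assoc, h1, smul_mul_assoc, smul_smul,
      mul_assoc, ← pow_add]
    congr 2
    ring

theorem qcomm_monomial_mul {F A : Type*} [Field F] [Ring A] [Algebra F A] {q : F} {x y : A}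
    (h : y * x = q • (x * y)) (i j k l : ℕ) :
    x ^ i * y ^ j * (x ^ k * y ^ l) = q ^ (j * k) • (x ^ (i + k) * y ^ (j + l)) := by
  rw [mul_assoc, ← mul_assoc (y ^ j), qcomm_pow_pow h, smul_mul_assoc, mul_smul_comm, mul_assoc,
    ← pow_add, ← mul_assoc, ← pow_add]

theorem qcomm_monomial_pow {F A : Type*} [Field F] [Ring A] [Algebra F A] {q : F} {x y : A}
    (h : y * x = q • (x * y)) (i j k : ℕ) :
    ∃ e : ℕ, (x ^ i * y ^ j) ^ k = q ^ e • (x ^ (i * k) * y ^ (j * k)) := by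
  induction k with
  | zero => exact ⟨0, by simp⟩
  | succ k ih =>
    obtain ⟨e, he⟩ := ih
    refine ⟨e + j * k * i, ?_⟩
    rw [pow_succ, he, smul_mul_assoc, qcomm_monomial_mul h, smul_smul, ← pow_add, mul_add_one,
      mul_add_one]

/-! ### The monomial basis and the center -/

section Five

variable {F : Type*} [Field F]

/-- Multiplication by `x` in the regular representation. -/
def regX (α : F) : Module.End F (Fin 5 → Fin 5 → F) where
  toFun f := ![α • f 4, f 0, f 1, f 2, f 3]
  map_add' f g := by ext k l; fin_cases k <;> simp
  map_smul' c f := by ext k l; fin_cases k <;> simp [mul_left_comm]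

/-- Multiplication by `y` in the regular representation. -/
def regY (ρ β : F) : Module.End F (Fin 5 → Fin 5 → F) where
  toFun f := fun k => ρ ^ (k : ℕ) • ![β * f k 4, f k 0, f k 1, f k 2, f k 3]
  map_add' f g := by ext k l; fin_cases l <;> simp [mul_add]
  map_smul' c f := by ext k l; fin_cases l <;> simp [mul_left_comm]

theorem regRel {ρ : F} (hρ : ρ ^ 5 = 1) (α β : F) ⦃a b : FreeAlgebra F (Fin 2)⦄
    (h : SymbolRel 5 ρ α β a b) :
    FreeAlgebra.lift F ![regX α, regY ρ β] a = FreeAlgebra.lift F ![regX α, regY ρ β] b := by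
  cases h with
  | x_pow =>
    refine LinearMap.ext fun f => funext fun k => funext fun l => ?_
    fin_cases k <;> simp [regX, pow_succ, Algebra.algebraMap_eq_smul_one]
  | y_pow =>
    refine LinearMap.ext fun f => funext fun k => funext fun l => ?_
    have h5 : (ρ ^ (k : ℕ)) ^ 5 = 1 := by rw [← pow_mul, mul_comm, pow_mul, hρ, one_pow]
    simp only [map_pow, FreeAlgebra.lift_ι_apply, AlgHom.commutes]
    fin_cases l <;> simp [regY, pow_succ, Algebra.algebraMap_eq_smul_one] <;>
      linear_combination (β * f k _) * h5
  | y_mul_x =>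
    refine LinearMap.ext fun f => funext fun k => funext fun l => ?_
    have h5 : ρ * ρ ^ 4 = 1 := by rw [← hρ]; ring
    fin_cases k <;> fin_cases l <;> simp [regX, regY] <;> first
      | ring1
      | linear_combination (-α * f 4 0) * h5
      | linear_combination (-α * f 4 1) * h5
      | linear_combination (-α * f 4 2) * h5
      | linear_combination (-α * f 4 3) * h5
      | linear_combination (-α * β * f 4 4) * h5

/-- The regular representation. -/
noncomputable def regRep {ρ : F} (hρ : ρ ^ 5 = 1) (α β : F) :
    SymbolAlgebra 5 ρ α β →ₐ[F] Module.End F (Fin 5 → Fin 5 → F) :=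
  RingQuot.liftAlgHom F ⟨FreeAlgebra.lift F ![regX α, regY ρ β], regRel hρ α β⟩

theorem regRep_x {ρ : F} (hρ : ρ ^ 5 = 1) (α β : F) : regRep hρ α β (x 5 ρ α β) = regX α := by
  simp [regRep, x]

theorem regRep_y {ρ : F} (hρ : ρ ^ 5 = 1) (α β : F) : regRep hρ α β (y 5 ρ α β) = regY ρ β := by
  simp [regRep, y]

/-- The monomial `x ^ i y ^ j`. -/
noncomputable def mono (ρ α β : F) (n : Fin 5 × Fin 5) : SymbolAlgebra 5 ρ α β :=
  x 5 ρ α β ^ (n.1 : ℕ) * y 5 ρ α β ^ (n.2 : ℕ)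

/-- The coordinates of an element with respect to the monomials. -/
noncomputable def coord {ρ : F} (hρ : ρ ^ 5 = 1) (α β : F) :
    SymbolAlgebra 5 ρ α β →ₗ[F] (Fin 5 × Fin 5 → F) where
  toFun a n := regRep hρ α β a (Pi.single 0 (Pi.single 0 1)) n.1 n.2
  map_add' a b := by ext; simp
  map_smul' c a := by ext; simp

theorem regX_single (α : F) (k : Fin 5) (hk : k ≠ 4) (g : Fin 5 → F) :
    regX α (Pi.single k g) = Pi.single (k + 1) g := by
  funext l
  fin_cases k <;> fin_cases l <;> simp [regX] at hk ⊢

theorem regY_single (ρ β : F) (k : Fin 5) (hk : k ≠ 4) :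
    regY ρ β (Pi.single 0 (Pi.single k 1)) = Pi.single 0 (Pi.single (k + 1) 1) := by
  funext i l
  by_cases hi : i = 0
  · subst hi
    fin_cases k <;> fin_cases l <;> simp [regY] at hk ⊢
  · fin_cases l <;> simp [regY, hi]

/-- The vector `Pi.single 0 (Pi.single 0 1)` plays the role of `1`; acting on it, `y ^ j` and then
`x ^ i` shift the indices without wrapping around. This gives the independence of the monomials. -/
theorem coord_mono {ρ : F} (hρ : ρ ^ 5 = 1) (α β : F) (n : Fin 5 × Fin 5) :
    coord hρ α β (mono ρ α β n) = Pi.single n 1 := by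
  obtain ⟨i, j⟩ := n
  have hy : ∀ j : ℕ, ∀ hj : j < 5, (regY ρ β ^ j) (Pi.single 0 (Pi.single 0 1)) =
      Pi.single 0 (Pi.single ⟨j, hj⟩ 1) := by
    intro j
    induction j with
    | zero => intro _; rfl
    | succ j ih =>
      intro hj
      rw [pow_succ', Module.End.mul_apply, ih (by omega), regY_single _ _ _ (by
        intro h; simp [Fin.ext_iff] at h; omega)]
      congr 2
      simp [Fin.ext_iff, Fin.val_add]; omega
  have hx : ∀ i : ℕ, ∀ hi : i < 5, ∀ g, (regX α ^ i) (Pi.single 0 g) =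
      Pi.single ⟨i, hi⟩ g := by
    intro j
    induction j with
    | zero => intro _ _; rfl
    | succ j ih =>
      intro hj g
      rw [pow_succ', Module.End.mul_apply, ih (by omega), regX_single _ _ (by
        intro h; simp [Fin.ext_iff] at h; omega)]
      congr 1
      simp [Fin.ext_iff, Fin.val_add]; omega
  funext p
  simp only [coord, mono, map_mul, map_pow, regRep_x, regRep_y, LinearMap.coe_mk, AddHom.coe_mk,
    Module.End.mul_apply]
  rw [hy j j.2, hx i i.2]
  obtain ⟨p, q⟩ := p
  by_cases h1 : p = i
  · subst h1
    simp [Pi.single_apply]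
  · simp [h1]

/-- Every monomial in the generators is a nonzero multiple of a reduced one. -/
theorem monomial_eq_smul {ρ α β : F} (hα : α ≠ 0) (hβ : β ≠ 0) (i j : ℕ) :
    ∃ c : F, c ≠ 0 ∧ x 5 ρ α β ^ i * y 5 ρ α β ^ j =
      c • mono ρ α β (Fin.ofNat 5 i, Fin.ofNat 5 j) := by
  refine ⟨α ^ (i / 5) * β ^ (j / 5), by positivity, ?_⟩
  conv_lhs => rw [← Nat.div_add_mod i 5, ← Nat.div_add_mod j 5]
  rw [pow_add, pow_mul, x_pow_self, pow_add, pow_mul, y_pow_self, ← map_pow, ← map_pow,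
    mono]
  simp only [Algebra.algebraMap_eq_smul_one, smul_mul_assoc, one_mul, mul_smul_comm, smul_smul,
    Fin.val_ofNat]
  rw [mul_comm]

/-- The span of the reduced monomials contains `1` and is stable under left multiplication by the
generators, so it is the whole algebra. -/
theorem sum_coord {ρ : F} (hρ : ρ ^ 5 = 1) {α β : F} (hα : α ≠ 0) (hβ : β ≠ 0)
    (a : SymbolAlgebra 5 ρ α β) : ∑ n, coord hρ α β a n • mono ρ α β n = a := by
  let S : Submodule F (SymbolAlgebra 5 ρ α β) := Submodule.span F (Set.range (mono ρ α β))
  have hred : ∀ i j : ℕ, x 5 ρ α β ^ i * y 5 ρ α β ^ j ∈ S := by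
    intro i j
    obtain ⟨c, -, hc⟩ := monomial_eq_smul (ρ := ρ) hα hβ i j
    rw [hc]
    exact S.smul_mem _ (Submodule.subset_span ⟨_, rfl⟩)
  have hmul : ∀ b ∈ S, x 5 ρ α β * b ∈ S ∧ y 5 ρ α β * b ∈ S := by
    intro b hb
    induction hb using Submodule.span_induction with
    | mem b hb =>
      obtain ⟨n, rfl⟩ := hb
      refine ⟨?_, ?_⟩
      · rw [mono, ← mul_assoc, ← pow_succ']
        exact hred _ _
      · have := qcomm_monomial_mul (y_mul_x (d := 5) (ρ := ρ) (α := α) (β := β)) 0 1 n.1 n.2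
        simp only [pow_zero, one_mul, pow_one] at this
        rw [mono, this]
        exact S.smul_mem _ (hred _ _)
    | zero => simp
    | add b c _ _ hb hc => simpa [mul_add] using ⟨S.add_mem hb.1 hc.1, S.add_mem hb.2 hc.2⟩
    | smul r b _ hb => simpa using ⟨S.smul_mem r hb.1, S.smul_mem r hb.2⟩
  have hgen : ∀ u : FreeAlgebra F (Fin 2), ∀ b ∈ S,
      RingQuot.mkAlgHom F (SymbolRel 5 ρ α β) u * b ∈ S := by
    intro u
    induction u using FreeAlgebra.induction with
    | grade0 r =>
      intro b hb
      rw [AlgHom.commutes, ← Algebra.smul_def]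
      exact S.smul_mem r hb
    | grade1 k =>
      intro b hb
      fin_cases k
      · exact (hmul b hb).1
      · exact (hmul b hb).2
    | mul u v hu hv =>
      intro b hb
      rw [map_mul, mul_assoc]
      exact hu _ (hv _ hb)
    | add u v hu hv =>
      intro b hb
      rw [map_add, add_mul]
      exact S.add_mem (hu _ hb) (hv _ hb)
  have ha : a ∈ S := by
    obtain ⟨u, rfl⟩ := RingQuot.mkAlgHom_surjective F (SymbolRel 5 ρ α β) a
    simpa using hgen u 1 (by simpa using hred 0 0)
  induction ha using Submodule.span_induction with
  | mem b hb =>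
    obtain ⟨n, rfl⟩ := hb
    simp [coord_mono, Pi.single_apply]
  | zero => simp
  | add b c _ _ hb hc => simp [add_smul, Finset.sum_add_distrib, hb, hc]
  | smul r b _ hb => simp [mul_smul, ← Finset.smul_sum, hb]

theorem coord_injective {ρ : F} (hρ : ρ ^ 5 = 1) {α β : F} (hα : α ≠ 0) (hβ : β ≠ 0) :
    Function.Injective (coord hρ α β) := by
  intro a b h
  rw [← sum_coord hρ hα hβ a, ← sum_coord hρ hα hβ b, h]

theorem mem_center_of_commute {ρ α β : F} {a : SymbolAlgebra 5 ρ α β}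
    (hx : Commute (x 5 ρ α β) a) (hy : Commute (y 5 ρ α β) a) :
    a ∈ Set.center (SymbolAlgebra 5 ρ α β) := by
  rw [Semigroup.mem_center_iff]
  intro b
  obtain ⟨u, rfl⟩ := RingQuot.mkAlgHom_surjective F (SymbolRel 5 ρ α β) b
  change Commute _ _
  induction u using FreeAlgebra.induction with
  | grade0 r =>
    rw [AlgHom.commutes]
    exact Algebra.commutes r a
  | grade1 k =>
    fin_cases k
    · exact hx
    · exact hy
  | mul u v hu hv => simpa using hu.mul_left hv
  | add u v hu hv => simpa using hu.add_left hv

theorem isUnit_x {ρ α β : F} (hα : α ≠ 0) : IsUnit (x 5 ρ α β) := by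
  rw [← isUnit_pow_iff (n := 5) (by norm_num), x_pow_self]
  exact (IsUnit.mk0 α hα).map _

theorem isUnit_y {ρ α β : F} (hβ : β ≠ 0) : IsUnit (y 5 ρ α β) := by
  rw [← isUnit_pow_iff (n := 5) (by norm_num), y_pow_self]
  exact (IsUnit.mk0 β hβ).map _

/-- Commuting with `y` multiplies the coordinate at `(i, j)` by `ρ ^ i`, commuting with `x` by a
power of `ρ` depending on `j`. One of the two factors differs from `1` unless `(i, j) = 0`. -/
theorem coord_eq_zero_of_mem_center {ρ : F} (hρ : IsPrimitiveRoot ρ 5) {α β : F} (hα : α ≠ 0)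
    (hβ : β ≠ 0) {a : SymbolAlgebra 5 ρ α β} (ha : a ∈ Set.center (SymbolAlgebra 5 ρ α β))
    {n : Fin 5 × Fin 5} (hn : n ≠ 0) : coord hρ.pow_eq_one α β a n = 0 := by
  rw [Semigroup.mem_center_iff] at ha
  have hlin : ∀ f : Fin 5 × Fin 5 → F, ∑ n, f n • mono ρ α β n = 0 → ∀ n, f n = 0 := by
    intro f hf n
    have := congrArg (fun b => coord hρ.pow_eq_one α β b n) hf
    simpa [coord_mono, Pi.single_apply] using this
  have key1 : ∀ n, (ρ ^ (n.1 : ℕ) - 1) * coord hρ.pow_eq_one α β a n = 0 := by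
    refine hlin _ ?_
    rw [← (isUnit_y hβ).mul_left_eq_zero, Finset.sum_mul]
    have h := ha (y 5 ρ α β)
    conv at h => enter [1, 2]; rw [← sum_coord hρ.pow_eq_one hα hβ a]
    conv at h => enter [2, 1]; rw [← sum_coord hρ.pow_eq_one hα hβ a]
    rw [Finset.mul_sum, Finset.sum_mul, ← sub_eq_zero, ← Finset.sum_sub_distrib] at h
    rw [← h]
    refine Finset.sum_congr rfl fun n _ => ?_
    have := qcomm_monomial_mul (y_mul_x (d := 5) (ρ := ρ) (α := α) (β := β)) 0 1 n.1 n.2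
    simp only [pow_zero, one_mul, pow_one] at this
    rw [mul_smul_comm, mono, this, smul_mul_assoc, smul_mul_assoc, mul_assoc, ← pow_succ,
      zero_add, add_comm 1]
    module
  have key2 : ∀ n, (1 - ρ ^ (n.2 : ℕ)) * coord hρ.pow_eq_one α β a n = 0 := by
    refine hlin _ ?_
    rw [← (isUnit_x hα).mul_right_eq_zero, Finset.mul_sum]
    have h := ha (x 5 ρ α β)
    conv at h => enter [1, 2]; rw [← sum_coord hρ.pow_eq_one hα hβ a]
    conv at h => enter [2, 1]; rw [← sum_coord hρ.pow_eq_one hα hβ a]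
    rw [Finset.mul_sum, Finset.sum_mul, ← sub_eq_zero, ← Finset.sum_sub_distrib] at h
    rw [← h]
    refine Finset.sum_congr rfl fun n _ => ?_
    have := qcomm_monomial_mul (y_mul_x (d := 5) (ρ := ρ) (α := α) (β := β)) n.1 n.2 1 0
    simp only [pow_zero, mul_one, pow_one] at this
    rw [mul_smul_comm, smul_mul_assoc, mono, this, mul_smul_comm, ← mul_assoc, ← pow_succ',
      add_zero]
    module
  have hne : ∀ k : Fin 5, k ≠ 0 → ρ ^ (k : ℕ) ≠ 1 := by
    intro k hk h
    have := Nat.le_of_dvd (by have := Fin.pos_iff_ne_zero.mpr hk; exact this)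
      ((hρ.pow_eq_one_iff_dvd _).1 h)
    omega
  rcases not_and_or.1 (fun h : n.1 = 0 ∧ n.2 = 0 => hn (Prod.ext h.1 h.2)) with h | h
  · exact (mul_eq_zero.1 (key1 n)).resolve_left (sub_ne_zero.2 (hne _ h))
  · exact (mul_eq_zero.1 (key2 n)).resolve_left (sub_ne_zero.2 (hne _ h).symm)

end Five
end SymbolAlgebra

/-! ### Expansion of fifth powers into words -/

/-- The sum of all distinct words of length `N` whose letters form the multiset `k`. -/
def shuffle {ι A : Type*} [DecidableEq ι] [Semiring A] (b : ι → A) : ℕ → Multiset ι → A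
  | 0, _ => 1
  | N + 1, k => ∑ i ∈ k.toFinset, b i * shuffle b N (k.erase i)

theorem sum_smul_pow_eq {ι F A : Type*} [Fintype ι] [DecidableEq ι] [CommSemiring F] [Semiring A]
    [Algebra F A] (b : ι → A) (z : ι → F) (N : ℕ) :
    (∑ i, z i • b i) ^ N =
      ∑ k : Sym ι N, ((k : Multiset ι).map z).prod • shuffle b N (k : Multiset ι) := by
  induction N with
  | zero =>
    rw [pow_zero, Fintype.sum_unique]
    have : ((default : Sym ι 0) : Multiset ι) = 0 := rfl
    simp [this, shuffle]
  | succ N ih =>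
    rw [pow_succ', ih, Finset.sum_mul_sum]
    simp_rw [shuffle, Finset.smul_sum]
    rw [Finset.sum_sigma', Finset.sum_sigma']
    -- A first letter with a multiset of `N` remaining letters is the same as a multiset of size `N
    -- + 1` with a marked element.
    refine Finset.sum_bij' (fun p _ => ⟨p.1 ::ₛ p.2, p.1⟩)
      (fun p hp => ⟨p.2, p.1.erase p.2 (by simpa using hp)⟩) ?_ ?_ ?_ ?_ ?_
    · intro p _
      simp
    · simp
    · intro p _
      simp
    · rintro ⟨k, i⟩ hp
      simp
    · rintro ⟨i, k⟩ _
      have : ((i ::ₛ k : Sym ι (N + 1)) : Multiset ι) = i ::ₘ (k : Multiset ι) := rfl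
      simp only [this, Multiset.map_cons, Multiset.prod_cons, Multiset.erase_cons_head,
        smul_mul_smul_comm]

namespace SymbolAlgebra

/-- The scalar by which the sum of all words with letters `k` differs from the ordered monomial. -/
def qshuffle {R : Type*} [CommSemiring R] (q : R) : ℕ → Multiset (Fin 5 × Fin 5) → R
  | 0, _ => 1
  | N + 1, k => ∑ i ∈ k.toFinset,
      q ^ ((i.2 : ℕ) * ((k.erase i).map (fun n => (n.1 : ℕ))).sum) * qshuffle q N (k.erase i)

variable {F : Type*} [Field F]

theorem shuffle_mono (ρ α β : F) (N : ℕ) (k : Multiset (Fin 5 × Fin 5)) (hk : k.card = N) :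
    shuffle (mono ρ α β) N k = qshuffle ρ N k •
      (x 5 ρ α β ^ (k.map (fun n => (n.1 : ℕ))).sum *
        y 5 ρ α β ^ (k.map (fun n => (n.2 : ℕ))).sum) := by
  induction N generalizing k with
  | zero =>
    rw [Multiset.card_eq_zero] at hk
    simp [shuffle, qshuffle, hk]
  | succ N ih =>
    rw [shuffle, qshuffle, Finset.sum_smul]
    refine Finset.sum_congr rfl fun i hi => ?_
    have hi' : i ∈ k := by simpa using hi
    have hc := Multiset.cons_erase hi'
    have hcard : (k.erase i).card = N := by rw [Multiset.card_erase_of_mem hi', hk]; rfl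
    rw [ih _ hcard, mono, mul_smul_comm, qcomm_monomial_mul y_mul_x, smul_smul, mul_comm]
    conv_rhs => rw [← hc]
    simp

theorem ofNat_sum_val (k : Multiset (Fin 5 × Fin 5)) :
    (Fin.ofNat 5 (k.map (fun n => (n.1 : ℕ))).sum,
      Fin.ofNat 5 (k.map (fun n => (n.2 : ℕ))).sum) = k.sum := by
  induction k using Multiset.induction with
  | empty => rfl
  | cons a k ih =>
    rw [Multiset.sum_cons, ← ih]
    simp only [Multiset.map_cons, Multiset.sum_cons]
    ext <;> simp [Fin.val_add]

theorem coord_shuffle {ρ : F} (hρ : ρ ^ 5 = 1) {α β : F} (hα : α ≠ 0) (hβ : β ≠ 0) (N : ℕ)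
    (k : Multiset (Fin 5 × Fin 5)) (hk : k.card = N) :
    ∃ c : F, c ≠ 0 ∧ ∀ n, coord hρ α β (shuffle (mono ρ α β) N k) n =
      if n = k.sum then qshuffle ρ N k * c else 0 := by
  obtain ⟨c, hc, h⟩ := monomial_eq_smul (ρ := ρ) hα hβ (k.map (fun n => (n.1 : ℕ))).sum
    (k.map (fun n => (n.2 : ℕ))).sum
  refine ⟨c, hc, fun n => ?_⟩
  rw [shuffle_mono _ _ _ _ _ hk, h, ofNat_sum_val, map_smul, map_smul, coord_mono]
  simp [Pi.single_apply]

theorem coord_pow_five {ρ : F} (hρ : IsPrimitiveRoot ρ 5) {α β : F} (hα : α ≠ 0) (hβ : β ≠ 0)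
    {V : Submodule F (SymbolAlgebra 5 ρ α β)} (hV : IsDCentralSpace 5 V)
    {v : SymbolAlgebra 5 ρ α β} (hv : v ∈ V) {n : Fin 5 × Fin 5} (hn : n ≠ 0) :
    coord hρ.pow_eq_one α β (v ^ 5) n = 0 := by
  by_cases h0 : v = 0
  · simp [h0]
  · exact coord_eq_zero_of_mem_center hρ hα hβ (hV v hv h0).2.1 hn

theorem multiset_prod_monomial {ι σ : Type*} (e : ι → σ →₀ ℕ) (c : ι → F) (k : Multiset ι) :
    (k.map fun i => MvPolynomial.monomial (e i) (c i)).prod =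
      MvPolynomial.monomial (k.map e).sum (k.map c).prod := by
  induction k using Multiset.induction with
  | empty => simp
  | cons a k ih => simp [ih, MvPolynomial.monomial_mul]

/-- The coordinate of the fifth power at `k.sum` is a polynomial in `s` that vanishes everywhere,
hence is zero over an infinite field. Its coefficient at `(k.map e).sum` collects the multisets with
the same exponent and the same degree; `huniq` leaves `k` alone. -/
theorem prod_mul_qshuffle_eq_zero_aux [Infinite F] {ρ : F} (hρ : IsPrimitiveRoot ρ 5) {α β : F}
    (hα : α ≠ 0) (hβ : β ≠ 0) {V : Submodule F (SymbolAlgebra 5 ρ α β)}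
    (hV : IsDCentralSpace 5 V) {σ : Type*} (e : Fin 5 × Fin 5 → σ →₀ ℕ) (c : Fin 5 × Fin 5 → F)
    (hmem : ∀ s : σ → F,
      ∑ n, MvPolynomial.eval s (MvPolynomial.monomial (e n) (c n)) • mono ρ α β n ∈ V)
    (k : Multiset (Fin 5 × Fin 5)) (hk : k.card = 5) (hsum : k.sum ≠ 0)
    (huniq : ∀ k' : Multiset (Fin 5 × Fin 5), k'.card = 5 → (k'.map e).sum = (k.map e).sum →
      k'.sum = k.sum → k' ≠ k → (k'.map c).prod = 0) :
    (k.map c).prod * qshuffle ρ 5 k = 0 := by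
  classical
  let φ : SymbolAlgebra 5 ρ α β → F := fun a => coord hρ.pow_eq_one α β a k.sum
  let H : MvPolynomial σ F := ∑ k' : Sym (Fin 5 × Fin 5) 5,
    MvPolynomial.monomial ((k' : Multiset _).map e).sum
      (((k' : Multiset _).map c).prod * φ (shuffle (mono ρ α β) 5 (k' : Multiset _)))
  have hH : H = 0 := by
    refine MvPolynomial.funext fun s => ?_
    have h1 := coord_pow_five hρ hα hβ hV (hmem s) hsum
    rw [sum_smul_pow_eq, map_sum, Finset.sum_apply] at h1
    rw [map_zero, ← h1, map_sum]
    refine Finset.sum_congr rfl fun k' _ => ?_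
    rw [map_smul, Pi.smul_apply, smul_eq_mul]
    have h2 : (((k' : Multiset _).map fun n =>
        MvPolynomial.eval s (MvPolynomial.monomial (e n) (c n)))).prod =
        MvPolynomial.eval s (MvPolynomial.monomial ((k' : Multiset _).map e).sum
          ((k' : Multiset _).map c).prod) := by
      rw [← multiset_prod_monomial, map_multiset_prod, Multiset.map_map]
      rfl
    rw [h2, MvPolynomial.eval_monomial, MvPolynomial.eval_monomial]
    ring
  have h3 := congrArg (MvPolynomial.coeff (k.map e).sum) hH
  rw [MvPolynomial.coeff_zero, MvPolynomial.coeff_sum,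
    Finset.sum_eq_single (Sym.mk k hk)] at h3
  · obtain ⟨d, hd, h⟩ := coord_shuffle hρ.pow_eq_one hα hβ 5 k hk
    have hcoe : ((Sym.mk k hk : Sym (Fin 5 × Fin 5) 5) : Multiset _) = k := rfl
    rw [MvPolynomial.coeff_monomial, hcoe, if_pos rfl] at h3
    change (k.map c).prod * coord hρ.pow_eq_one α β (shuffle (mono ρ α β) 5 k) k.sum = 0 at h3
    rw [h, if_pos rfl, ← mul_assoc] at h3
    exact (mul_eq_zero.1 h3).resolve_right hd
  · intro k' _ hne
    rw [MvPolynomial.coeff_monomial]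
    split_ifs with he
    · obtain ⟨d, -, h⟩ := coord_shuffle hρ.pow_eq_one hα hβ 5 (k' : Multiset _) k'.2
      change _ * coord hρ.pow_eq_one α β _ k.sum = 0
      rw [h]
      split_ifs with hs
      · rw [huniq k' k'.2 he hs.symm fun h => hne (Subtype.ext h), zero_mul]
      · rw [mul_zero]
    · rfl
  · simp

/-- Each monomial in `P` gets its own variable `some n`, and the remaining part of `v` gets the
single variable `none`. The exponent thus records `l` completely, but only the size of `r`. -/
theorem prod_mul_qshuffle_eq_zero [Infinite F] {ρ : F} (hρ : IsPrimitiveRoot ρ 5) {α β : F}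
    (hα : α ≠ 0) (hβ : β ≠ 0) {V : Submodule F (SymbolAlgebra 5 ρ α β)}
    (hV : IsDCentralSpace 5 V) (P : Finset (Fin 5 × Fin 5)) (hP : ∀ n ∈ P, mono ρ α β n ∈ V)
    {v : SymbolAlgebra 5 ρ α β} (hv : v ∈ V) (l r : Multiset (Fin 5 × Fin 5))
    (hl : ∀ n ∈ l, n ∈ P) (hr : ∀ n ∈ r, n ∉ P) (hcard : (l + r).card = 5)
    (hsum : (l + r).sum ≠ 0)
    (huniq : ∀ r' : Multiset (Fin 5 × Fin 5),
      (∀ n ∈ r', n ∉ P ∧ coord hρ.pow_eq_one α β v n ≠ 0) → r'.card = r.card →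
      r'.sum = r.sum → r' = r) :
    (r.map (coord hρ.pow_eq_one α β v)).prod * qshuffle ρ 5 (l + r) = 0 := by
  classical
  let f : Fin 5 × Fin 5 → Option (Fin 5 × Fin 5) := fun n => if n ∈ P then some n else none
  let e : Fin 5 × Fin 5 → Option (Fin 5 × Fin 5) →₀ ℕ := fun n => Finsupp.single (f n) 1
  let c : Fin 5 × Fin 5 → F := fun n => if n ∈ P then 1 else coord hρ.pow_eq_one α β v n
  have hmem : ∀ s : Option (Fin 5 × Fin 5) → F,
      ∑ n, MvPolynomial.eval s (MvPolynomial.monomial (e n) (c n)) • mono ρ α β n ∈ V := by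
    intro s
    -- Subtracting the `P`-coordinates of `v` keeps the element in `V` and makes the variables
    -- independent.
    have h1 : ∑ n, MvPolynomial.eval s (MvPolynomial.monomial (e n) (c n)) • mono ρ α β n =
        s none • v + ∑ n ∈ P, (s (some n) - s none * coord hρ.pow_eq_one α β v n) •
          mono ρ α β n := by
      conv_rhs => enter [1, 2]; rw [← sum_coord hρ.pow_eq_one hα hβ v]
      have h2 : ∀ g : Fin 5 × Fin 5 → SymbolAlgebra 5 ρ α β,
          ∑ n ∈ P, g n = ∑ n, if n ∈ P then g n else 0 := fun g => by simp
      rw [h2, Finset.smul_sum, ← Finset.sum_add_distrib]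
      refine Finset.sum_congr rfl fun n _ => ?_
      by_cases hn : n ∈ P
      · simp only [e, f, c, hn, if_true, MvPolynomial.eval_monomial]
        simp
        module
      · simp only [e, f, c, hn, if_false, MvPolynomial.eval_monomial]
        simp [smul_smul, mul_comm]
    rw [h1]
    exact V.add_mem (V.smul_mem _ hv) (V.sum_mem fun n hn => V.smul_mem _ (hP n hn))
  have hfilter : ∀ k : Multiset (Fin 5 × Fin 5), ∀ n ∈ P,
      (k.map e).sum (some n) = (k.filter (· ∈ P)).count n := by
    intro k n hn
    induction k using Multiset.induction with
    | empty => simp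
    | cons a k ih =>
      rw [Multiset.map_cons, Multiset.sum_cons, Finsupp.add_apply, ih]
      by_cases ha : a ∈ P
      · rw [Multiset.filter_cons_of_pos _ ha, Multiset.count_cons]
        by_cases hna : n = a
        · subst hna; simp [e, f, ha, add_comm]
        · simp [e, f, ha, hna]
      · rw [Multiset.filter_cons_of_neg _ ha]
        simp [e, f, ha]
  have hlr1 : (l + r).filter (· ∈ P) = l := by
    rw [Multiset.filter_add, Multiset.filter_eq_self.2 hl, Multiset.filter_eq_nil.2 hr, add_zero]
  have hlr2 : (l + r).filter (· ∉ P) = r := by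
    rw [Multiset.filter_add, Multiset.filter_eq_self.2 hr,
      Multiset.filter_eq_nil.2 (fun n hn h => h (hl n hn)), zero_add]
  have key := prod_mul_qshuffle_eq_zero_aux hρ hα hβ hV e c hmem (l + r) hcard hsum ?_
  · rw [Multiset.map_add, Multiset.prod_add] at key
    have hl1 : l.map c = l.map fun _ => 1 := Multiset.map_congr rfl fun n hn => if_pos (hl n hn)
    have hr1 : r.map c = r.map (coord hρ.pow_eq_one α β v) :=
      Multiset.map_congr rfl fun n hn => if_neg (hr n hn)
    rw [hl1, hr1] at key
    simpa using key
  · intro k hk he hs hne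
    by_contra hprod
    apply hne
    have hk1 : k.filter (· ∈ P) = l := by
      ext n
      by_cases hn : n ∈ P
      · rw [← hfilter k n hn, he, hfilter _ n hn, hlr1]
      · rw [Multiset.count_eq_zero_of_notMem, Multiset.count_eq_zero_of_notMem]
        · exact fun h => hn (hl n h)
        · exact fun h => hn (Multiset.mem_filter.1 h).2
    have hk2 := Multiset.filter_add_not (· ∈ P) k
    rw [hk1] at hk2
    rw [← hk2] at hs hk ⊢
    rw [Multiset.card_add] at hk hcard
    rw [Multiset.sum_add, Multiset.sum_add] at hs
    congr 1
    refine huniq _ (fun n hn => ?_) (by omega) (add_left_cancel hs)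
    rw [Multiset.mem_filter] at hn
    refine ⟨hn.2, fun h0 => hprod ?_⟩
    refine Multiset.prod_eq_zero (Multiset.mem_map.2 ⟨n, hn.1, ?_⟩)
    simp [c, hn.2, h0]

end SymbolAlgebra

/-! ### Computing with sums of fifth roots of unity -/

/-- Sums of powers of a fifth root of unity, given by the multiplicities of the exponents. -/
@[ext]
structure Cyc5 where
  (a b c d e : ℕ)

namespace Cyc5

def eval {R : Type*} [CommSemiring R] (q : R) (z : Cyc5) : R :=
  z.a + z.b * q + z.c * q ^ 2 + z.d * q ^ 3 + z.e * q ^ 4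

def add (z w : Cyc5) : Cyc5 := ⟨z.a + w.a, z.b + w.b, z.c + w.c, z.d + w.d, z.e + w.e⟩

/-- Multiplication by the root of unity. -/
def rot (z : Cyc5) : Cyc5 := ⟨z.e, z.a, z.b, z.c, z.d⟩

/-- Multiplication by a power of the root of unity. -/
def shift : ℕ → Cyc5 → Cyc5
  | 0, z => z
  | n + 1, z => shift n z.rot

def mul (z w : Cyc5) : Cyc5 where
  a := z.a * w.a + z.b * w.e + z.c * w.d + z.d * w.c + z.e * w.b
  b := z.a * w.b + z.b * w.a + z.c * w.e + z.d * w.d + z.e * w.c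
  c := z.a * w.c + z.b * w.b + z.c * w.a + z.d * w.e + z.e * w.d
  d := z.a * w.d + z.b * w.c + z.c * w.b + z.d * w.a + z.e * w.e
  e := z.a * w.e + z.b * w.d + z.c * w.c + z.d * w.b + z.e * w.a

/-- The product of the three nontrivial conjugates. -/
def cofactor (z : Cyc5) : Cyc5 :=
  mul ⟨z.a, z.d, z.b, z.e, z.c⟩ (mul ⟨z.a, z.c, z.e, z.b, z.d⟩ ⟨z.a, z.e, z.d, z.c, z.b⟩)

/-- The norm is `5 ^ 4`. -/
def hasNorm625 (z : Cyc5) : Bool :=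
  let n := mul z z.cofactor
  n.c == n.b && n.d == n.b && n.e == n.b && n.a == n.b + 625

variable {R : Type*} [CommRing R] {q : R}

theorem eval_add (z w : Cyc5) : (add z w).eval q = z.eval q + w.eval q := by
  simp only [eval, add]; push_cast; ring

theorem eval_rot (hq : q ^ 5 = 1) (z : Cyc5) : z.rot.eval q = q * z.eval q := by
  simp only [eval, rot]; linear_combination (-z.e : R) * hq

theorem eval_shift (hq : q ^ 5 = 1) (n : ℕ) (z : Cyc5) : (shift n z).eval q = q ^ n * z.eval q := by
  induction n generalizing z with
  | zero => simp [shift]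
  | succ n ih => rw [shift, ih, eval_rot hq, pow_succ, mul_assoc]

theorem eval_mul (hq : q ^ 5 = 1) (z w : Cyc5) : (mul z w).eval q = z.eval q * w.eval q := by
  have h6 : q ^ 6 = q := by rw [pow_succ, hq, one_mul]
  have h7 : q ^ 7 = q ^ 2 := by rw [show 7 = 5 + 2 from rfl, pow_add, hq, one_mul]
  have h8 : q ^ 8 = q ^ 3 := by rw [show 8 = 5 + 3 from rfl, pow_add, hq, one_mul]
  simp only [eval, mul]
  push_cast
  ring_nf
  rw [hq, h6, h7, h8]
  ring

/-- Since `1 + q + q ^ 2 + q ^ 3 + q ^ 4 = 0`, the product with the conjugates evaluates to `625`,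
which is nonzero in every field with a primitive fifth root of unity. One integer computation
therefore serves all characteristics. The value `5 ^ 4` is the norm of `5`. -/
theorem eval_ne_zero {F : Type*} [Field F] {q : F} (hq : IsPrimitiveRoot q 5) {z : Cyc5}
    (hz : z.hasNorm625 = true) : z.eval q ≠ 0 := by
  intro h0
  have h := eval_mul hq.pow_eq_one z z.cofactor
  rw [h0, zero_mul] at h
  simp only [hasNorm625, Bool.and_eq_true, beq_iff_eq] at hz
  obtain ⟨⟨⟨hc, hd⟩, he⟩, ha⟩ := hz
  rw [eval, hc, hd, he, ha] at h
  have hg := hq.geom_sum_eq_zero (by norm_num)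
  simp only [Finset.sum_range_succ, Finset.sum_range_zero] at hg
  have h5 : (625 : F) = 0 := by
    push_cast at h
    linear_combination h - ((mul z z.cofactor).b : F) * hg
  have h5' : ((5 : ℕ) : F) ≠ 0 := by
    have : NeZero ((5 : ℕ) : F) := hq.neZero'
    exact this.out
  apply h5'
  have : (5 : F) ^ 4 = 0 := by rw [← h5]; norm_num
  exact_mod_cast pow_eq_zero_iff (by norm_num) |>.1 this

end Cyc5

namespace Cyc5

/-- Encoding as a single natural number in base `4096`. -/
def pack (z : Cyc5) : ℕ :=
  z.a + 4096 * z.b + 4096 ^ 2 * z.c + 4096 ^ 3 * z.d + 4096 ^ 4 * z.e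

def total (z : Cyc5) : ℕ := z.a + z.b + z.c + z.d + z.e

def unpack (v : ℕ) : Cyc5 :=
  ⟨v % 4096, v / 4096 % 4096, v / 4096 ^ 2 % 4096, v / 4096 ^ 3 % 4096, v / 4096 ^ 4 % 4096⟩

theorem unpack_pack {z : Cyc5} (hz : z.total < 4096) : unpack z.pack = z := by
  obtain ⟨a, b, c, d, e⟩ := z
  simp only [total, pack, unpack, Cyc5.mk.injEq] at hz ⊢
  norm_num
  omega

theorem total_add (z w : Cyc5) : (add z w).total = z.total + w.total := by
  simp only [total, add]; omega

theorem pack_add (z w : Cyc5) : (add z w).pack = z.pack + w.pack := by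
  simp only [pack, add]; ring

theorem total_shift (n : ℕ) (z : Cyc5) : (shift n z).total = z.total := by
  induction n generalizing z with
  | zero => rfl
  | succ n ih => rw [shift, ih]; simp only [total, rot]; omega

/-- Modulo `4096 ^ 5 - 1`, multiplication by `4096` rotates the five digits cyclically. The bound on
the total prevents carries and excludes the number `4096 ^ 5 - 1` itself. -/
theorem pack_shift (n : ℕ) {z : Cyc5} (hz : z.total < 4096) :
    (shift n z).pack = z.pack * 4096 ^ n % (4096 ^ 5 - 1) := by
  induction n generalizing z with
  | zero =>
    obtain ⟨a, b, c, d, e⟩ := z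
    simp only [total, pack, shift] at hz ⊢
    norm_num
    omega
  | succ n ih =>
    have h1 : z.rot.total < 4096 := by simp only [total, rot] at hz ⊢; omega
    have h2 : z.rot.pack = z.pack * 4096 % (4096 ^ 5 - 1) := by
      obtain ⟨a, b, c, d, e⟩ := z
      simp only [total, pack, rot] at hz ⊢
      norm_num
      omega
    rw [shift, ih h1, h2, Nat.mod_mul_mod, pow_succ' 4096 n, mul_assoc]

end Cyc5

/-! ### The finite computation on monomials -/

namespace SymbolAlgebra

/-- The multiset with the given multiplicities of `x`, `y`, `m`, `n`, `p`. -/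
def letters (m n p : Fin 5 × Fin 5) (a b c d e : ℕ) : Multiset (Fin 5 × Fin 5) :=
  Multiset.replicate a (1, 0) + (Multiset.replicate b (0, 1) + (Multiset.replicate c m +
    (Multiset.replicate d n + Multiset.replicate e p)))

/-- `qshuffle` of `letters`, as an encoded sum of roots of unity. -/
def packedShuffle (mi mj ni nj pi pj : ℕ) : ℕ → ℕ → ℕ → ℕ → ℕ → ℕ → ℕ
  | 0, _, _, _, _, _ => 1
  | N + 1, a, b, c, d, e =>
    (match a with
      | 0 => 0
      | a + 1 => packedShuffle mi mj ni nj pi pj N a b c d e) +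
    ((match b with
      | 0 => 0
      | b + 1 => packedShuffle mi mj ni nj pi pj N a b c d e *
          4096 ^ (a + c * mi + d * ni + e * pi) % (4096 ^ 5 - 1)) +
    ((match c with
      | 0 => 0
      | c + 1 => packedShuffle mi mj ni nj pi pj N a b c d e *
          4096 ^ (mj * (a + c * mi + d * ni + e * pi)) % (4096 ^ 5 - 1)) +
    ((match d with
      | 0 => 0
      | d + 1 => packedShuffle mi mj ni nj pi pj N a b c d e *
          4096 ^ (nj * (a + c * mi + d * ni + e * pi)) % (4096 ^ 5 - 1)) +
    (match e with
      | 0 => 0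
      | e + 1 => packedShuffle mi mj ni nj pi pj N a b c d e *
          4096 ^ (pj * (a + c * mi + d * ni + e * pi)) % (4096 ^ 5 - 1)))))

def normCheck : ℕ → Bool
  | 0 => false
  | v + 1 => (Cyc5.unpack (v + 1)).hasNorm625

/-- The words with the given letters have a sum that is nonzero and not central. -/
def obstructs (m n p : Fin 5 × Fin 5) (d e : ℕ) (t : ℕ × ℕ × ℕ) : Bool :=
  ((t.1 + t.2.2 * m.1 + d * n.1 + e * p.1) % 5 != 0 ||
    (t.2.1 + t.2.2 * m.2 + d * n.2 + e * p.2) % 5 != 0) &&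
  normCheck (packedShuffle m.1 m.2 n.1 n.2 p.1 p.2 5 t.1 t.2.1 t.2.2 d e)

theorem sum_toFinset_replicate_add {ι M : Type*} [DecidableEq ι] [AddCommMonoid M] (g : ι → M)
    (i : ι) (a : ℕ) (k : Multiset ι) (h : i ∉ k ∨ a = 0) :
    ∑ j ∈ (Multiset.replicate a i + k).toFinset, g j =
      (if a = 0 then 0 else g i) + ∑ j ∈ k.toFinset, g j := by
  by_cases ha : a = 0
  · simp [ha]
  · have hi : i ∉ k.toFinset := by simpa using h.resolve_right ha
    rw [if_neg ha, ← Finset.sum_insert hi]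
    refine Finset.sum_congr ?_ fun _ _ => rfl
    ext j
    simp [ha]

theorem sum_toFinset_letters {M : Type*} [AddCommMonoid M] (g : Fin 5 × Fin 5 → M)
    {m n p : Fin 5 × Fin 5} {a b c d e : ℕ} (hmx : m ≠ (1, 0)) (hmy : m ≠ (0, 1))
    (hn : n ∉ [(1, 0), (0, 1), m] ∨ d = 0) (hp : p ∉ [(1, 0), (0, 1), m, n] ∨ e = 0) :
    ∑ j ∈ (letters m n p a b c d e).toFinset, g j =
      (if a = 0 then 0 else g (1, 0)) + ((if b = 0 then 0 else g (0, 1)) +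
        ((if c = 0 then 0 else g m) + ((if d = 0 then 0 else g n) +
          (if e = 0 then 0 else g p)))) := by
  have hp' : p ∉ (0 : Multiset (Fin 5 × Fin 5)) ∨ e = 0 := by simp
  have key := sum_toFinset_replicate_add g p e 0 hp'
  rw [add_zero] at key
  simp only [List.mem_cons, List.not_mem_nil, or_false, not_or] at hn hp
  rw [letters, sum_toFinset_replicate_add, sum_toFinset_replicate_add,
    sum_toFinset_replicate_add, sum_toFinset_replicate_add, key]
  · simp
  all_goals
    simp only [Multiset.mem_add, Multiset.mem_replicate]
    have : ((1, 0) : Fin 5 × Fin 5) ≠ (0, 1) := by decide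
    grind

/-- The recursion removes the first letter, as in `qshuffle`. At most `5 ^ N` words occur, and `5 ^
5 < 4096`, so the digits never overflow. Distinctness of the letters that occur ensures that no
first letter is counted twice. -/
theorem packedShuffle_spec {m n p : Fin 5 × Fin 5} (hmx : m ≠ (1, 0)) (hmy : m ≠ (0, 1))
    {R : Type*} [CommRing R] {q : R} (hq : q ^ 5 = 1)
    (N : ℕ) (hN : N ≤ 5) (a b c d e : ℕ)
    (hn : n ∉ [(1, 0), (0, 1), m] ∨ d = 0) (hp : p ∉ [(1, 0), (0, 1), m, n] ∨ e = 0) :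
    ∃ z : Cyc5, z.total ≤ 5 ^ N ∧
      z.pack = packedShuffle m.1 m.2 n.1 n.2 p.1 p.2 N a b c d e ∧
      z.eval q = qshuffle q N (letters m n p a b c d e) := by
  induction N generalizing a b c d e with
  | zero => exact ⟨⟨1, 0, 0, 0, 0⟩, by simp [Cyc5.total], by simp [Cyc5.pack, packedShuffle],
      by simp [Cyc5.eval, qshuffle]⟩
  | succ N ih =>
    have hlt : 5 ^ N < 4096 :=
      lt_of_le_of_lt (Nat.pow_le_pow_right (by norm_num) (show N ≤ 4 by omega)) (by norm_num)
    have zero_spec : ∃ z : Cyc5, z.total ≤ 5 ^ N ∧ z.pack = 0 ∧ z.eval q = 0 :=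
      ⟨⟨0, 0, 0, 0, 0⟩, by simp [Cyc5.total], by simp [Cyc5.pack], by simp [Cyc5.eval]⟩
    have step : ∀ (i : Fin 5 × Fin 5) (a b c d e : ℕ),
        (n ∉ [(1, 0), (0, 1), m] ∨ d = 0) → (p ∉ [(1, 0), (0, 1), m, n] ∨ e = 0) →
        ∀ k, k = i ::ₘ letters m n p a b c d e → ∃ z : Cyc5, z.total ≤ 5 ^ N ∧
          z.pack = packedShuffle m.1 m.2 n.1 n.2 p.1 p.2 N a b c d e *
            4096 ^ ((i.2 : ℕ) * (a + c * m.1 + d * n.1 + e * p.1)) % (4096 ^ 5 - 1) ∧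
          z.eval q = q ^ ((i.2 : ℕ) * ((k.erase i).map (fun n => (n.1 : ℕ))).sum) *
            qshuffle q N (k.erase i) := by
      intro i a b c d e hn hp k hk
      obtain ⟨z, h1, h2, h3⟩ := ih (by omega) a b c d e hn hp
      refine ⟨z.shift ((i.2 : ℕ) * (a + c * m.1 + d * n.1 + e * p.1)), ?_, ?_, ?_⟩
      · rwa [Cyc5.total_shift]
      · rw [Cyc5.pack_shift _ (h1.trans_lt hlt), h2]
      · rw [Cyc5.eval_shift hq, h3, hk, Multiset.erase_cons_head]
        congr 3
        simp [letters]
        ring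
    set k := letters m n p a b c d e with hk
    set g : Fin 5 × Fin 5 → R := fun i =>
      q ^ ((i.2 : ℕ) * ((k.erase i).map (fun n => (n.1 : ℕ))).sum) * qshuffle q N (k.erase i)
      with hg
    obtain ⟨z₁, t₁, p₁, e₁⟩ : ∃ z : Cyc5, z.total ≤ 5 ^ N ∧ z.pack = (match (generalizing := false) a with
        | 0 => 0
        | a + 1 => packedShuffle m.1 m.2 n.1 n.2 p.1 p.2 N a b c d e) ∧
        z.eval q = if a = 0 then 0 else g (1, 0) := by
      cases a with
      | zero => simpa using zero_spec
      | succ a =>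
        obtain ⟨z, h1, h2, h3⟩ := ih (by omega) a b c d e hn hp
        refine ⟨z, h1, h2, ?_⟩
        have hk' : k = (1, 0) ::ₘ letters m n p a b c d e := by
          simp [hk, letters, Multiset.replicate_succ]
        rw [if_neg (Nat.succ_ne_zero a), hg, h3, hk']
        simp
    obtain ⟨z₂, t₂, p₂, e₂⟩ : ∃ z : Cyc5, z.total ≤ 5 ^ N ∧ z.pack = (match (generalizing := false) b with
        | 0 => 0
        | b + 1 => packedShuffle m.1 m.2 n.1 n.2 p.1 p.2 N a b c d e *
            4096 ^ (a + c * m.1 + d * n.1 + e * p.1) % (4096 ^ 5 - 1)) ∧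
        z.eval q = if b = 0 then 0 else g (0, 1) := by
      cases b with
      | zero => simpa using zero_spec
      | succ b =>
        obtain ⟨z, h1, h2, h3⟩ := step (0, 1) a b c d e hn hp k
          (by simp [hk, letters, Multiset.replicate_succ])
        rw [if_neg (Nat.succ_ne_zero b)]
        exact ⟨z, h1, by simpa only [Fin.val_one, one_mul] using h2, h3⟩
    obtain ⟨z₃, t₃, p₃, e₃⟩ : ∃ z : Cyc5, z.total ≤ 5 ^ N ∧ z.pack = (match (generalizing := false) c with
        | 0 => 0
        | c + 1 => packedShuffle m.1 m.2 n.1 n.2 p.1 p.2 N a b c d e *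
            4096 ^ (m.2 * (a + c * m.1 + d * n.1 + e * p.1)) % (4096 ^ 5 - 1)) ∧
        z.eval q = if c = 0 then 0 else g m := by
      cases c with
      | zero => simpa using zero_spec
      | succ c =>
        rw [if_neg (Nat.succ_ne_zero c)]
        exact step m a b c d e hn hp k (by simp [hk, letters, Multiset.replicate_succ])
    obtain ⟨z₄, t₄, p₄, e₄⟩ : ∃ z : Cyc5, z.total ≤ 5 ^ N ∧ z.pack = (match (generalizing := false) d with
        | 0 => 0
        | d + 1 => packedShuffle m.1 m.2 n.1 n.2 p.1 p.2 N a b c d e *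
            4096 ^ (n.2 * (a + c * m.1 + d * n.1 + e * p.1)) % (4096 ^ 5 - 1)) ∧
        z.eval q = if d = 0 then 0 else g n := by
      cases d with
      | zero => simpa using zero_spec
      | succ d =>
        rw [if_neg (Nat.succ_ne_zero d)]
        exact step n a b c d e (Or.inl (hn.resolve_right (Nat.succ_ne_zero d))) hp k
          (by simp [hk, letters, Multiset.replicate_succ])
    obtain ⟨z₅, t₅, p₅, e₅⟩ : ∃ z : Cyc5, z.total ≤ 5 ^ N ∧ z.pack = (match (generalizing := false) e with
        | 0 => 0
        | e + 1 => packedShuffle m.1 m.2 n.1 n.2 p.1 p.2 N a b c d e *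
            4096 ^ (p.2 * (a + c * m.1 + d * n.1 + e * p.1)) % (4096 ^ 5 - 1)) ∧
        z.eval q = if e = 0 then 0 else g p := by
      cases e with
      | zero => simpa using zero_spec
      | succ e =>
        rw [if_neg (Nat.succ_ne_zero e)]
        exact step p a b c d e hn (Or.inl (hp.resolve_right (Nat.succ_ne_zero e))) k
          (by simp [hk, letters, Multiset.replicate_succ])
    refine ⟨z₁.add (z₂.add (z₃.add (z₄.add z₅))), ?_, ?_, ?_⟩
    · simp only [Cyc5.total_add]
      rw [pow_succ]
      omega
    · simp only [Cyc5.pack_add, p₁, p₂, p₃, p₄, p₅, packedShuffle]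
    · simp only [Cyc5.eval_add, e₁, e₂, e₃, e₄, e₅]
      rw [qshuffle, hk, sum_toFinset_letters _ hmx hmy hn hp]

theorem letters_sum (m n p : Fin 5 × Fin 5) (a b c d e : ℕ) :
    (letters m n p a b c d e).sum =
      (Fin.ofNat 5 (a + c * m.1 + d * n.1 + e * p.1),
        Fin.ofNat 5 (b + c * m.2 + d * n.2 + e * p.2)) := by
  rw [← ofNat_sum_val]
  simp [letters, add_assoc]

theorem qshuffle_ne_zero_of_obstructs {F : Type*} [Field F] {q : F} (hq : IsPrimitiveRoot q 5)
    {m n p : Fin 5 × Fin 5} (hmx : m ≠ (1, 0)) (hmy : m ≠ (0, 1)) {d e : ℕ} {t : ℕ × ℕ × ℕ}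
    (hn : n ∉ [(1, 0), (0, 1), m] ∨ d = 0) (hp : p ∉ [(1, 0), (0, 1), m, n] ∨ e = 0)
    (h : obstructs m n p d e t = true) :
    (letters m n p t.1 t.2.1 t.2.2 d e).sum ≠ 0 ∧
      qshuffle q 5 (letters m n p t.1 t.2.1 t.2.2 d e) ≠ 0 := by
  rw [obstructs, Bool.and_eq_true] at h
  obtain ⟨h1, h2⟩ := h
  refine ⟨fun h0 => ?_, ?_⟩
  · rw [letters_sum, Prod.mk_eq_zero] at h0
    simp only [Fin.ext_iff, Fin.val_ofNat, Fin.val_zero] at h0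
    simp [h0.1, h0.2] at h1
  · obtain ⟨z, hz1, hz2, hz3⟩ := packedShuffle_spec hmx hmy hq.pow_eq_one 5 le_rfl
      t.1 t.2.1 t.2.2 d e hn hp
    rw [← hz3]
    apply Cyc5.eval_ne_zero hq
    rw [← hz2] at h2
    cases hv : z.pack with
    | zero => simp [hv, normCheck] at h2
    | succ v =>
      rw [hv, normCheck, ← hv, Cyc5.unpack_pack (hz1.trans_lt (by norm_num))] at h2
      exact h2

/-- Triples of natural numbers with sum `N`. -/
def triples (N : ℕ) : List (ℕ × ℕ × ℕ) :=
  (List.range (N + 1)).flatMap fun a => (List.range (N + 1 - a)).map fun b => (a, b, N - a - b)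

/-- For an admissible third monomial `m`, the monomials other than `x`, `y`, `m` that pass the
linear conditions. -/
def candidates (m : Fin 5 × Fin 5) : List (Fin 5 × Fin 5) :=
  match m.1.val, m.2.val with
  | 1, 1 => [(1, 2), (1, 3), (1, 4), (2, 1), (3, 1), (4, 1)]
  | 1, 2 => [(1, 1), (1, 3), (1, 4), (2, 2)]
  | 1, 3 => [(1, 1), (1, 2), (1, 4), (2, 3)]
  | 1, 4 => [(1, 1), (1, 2), (1, 3), (2, 4), (3, 3), (4, 2)]
  | 2, 1 => [(1, 1), (2, 2), (3, 1), (4, 1)]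
  | 2, 3 => [(1, 1), (2, 4), (3, 3), (4, 2)]
  | 2, 4 => [(1, 3), (1, 4), (2, 2), (2, 3), (3, 2), (3, 3), (4, 1), (4, 2)]
  | 3, 1 => [(1, 1), (2, 1), (3, 2), (4, 1)]
  | 3, 2 => [(1, 1), (2, 4), (3, 3), (4, 2)]
  | 3, 3 => [(1, 3), (1, 4), (2, 3), (2, 4), (3, 1), (3, 2), (4, 1), (4, 2)]
  | 4, 1 => [(1, 1), (2, 1), (2, 4), (3, 1), (3, 3), (4, 2)]
  | 4, 2 => [(1, 4), (2, 2), (2, 3), (2, 4), (3, 1), (3, 2), (3, 3), (4, 1)]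
  | _, _ => []

/-- The monomials of the maximal spaces; the last one is the sum of the four preceding ones. -/
def family (t : Fin 7) (n : Fin 5 × Fin 5) : Bool :=
  match t.val with
  | 0 => n.2 == 1 || n == (1, 0)
  | 1 => n.1 == 1 || n == (0, 1)
  | 6 => n.1 + n.2 == 1 || (n.1 + n.2 == 0 && n != 0)
  | i => n.1 + n.2 == 1 || n == (Fin.ofNat 5 (3 * (i - 1)), Fin.ofNat 5 (2 * (i - 1)))

/-- Whether the pair `n, n'` is excluded by the quadratic conditions. -/
def incompatible (m n n' : Fin 5 × Fin 5) : Bool :=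
  ((candidates m).all fun p => (candidates m).all fun p' =>
    p + p' != n + n' || (p == n && p' == n') || (p == n' && p' == n)) &&
  (triples 3).any (if n = n' then obstructs m n n' 2 0 else obstructs m n n' 1 1)

/-- Whether family `t` contains `x`, `y`, `m` and all candidates compatible with `n₀`. -/
def familyWorks (m n₀ : Fin 5 × Fin 5) (t : Fin 7) : Bool :=
  family t (1, 0) && family t (0, 1) && family t m && (t != 6 || m.1 + m.2 == 1) &&
    (family t n₀ || incompatible m n₀ n₀) &&
    (candidates m).all fun n => family t n || incompatible m n₀ n || incompatible m n n

theorem obstructs_of_candidates_eq_nil : ∀ m : Fin 5 × Fin 5, m ≠ (1, 0) → m ≠ (0, 1) →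
    candidates m = [] → (triples 5).any (obstructs m 0 0 0 0) = true := by
  decide +kernel

theorem obstructs_of_not_mem_candidates : ∀ m : Fin 5 × Fin 5, candidates m ≠ [] →
    ∀ n, n ∈ (1, 0) :: (0, 1) :: m :: candidates m ∨
      (triples 4).any (obstructs m n 0 1 0) = true := by
  decide +kernel

/-- Once `n₀` is known to occur in `V`, every candidate outside the family is excluded, either
against `n₀` or by its own square. -/
theorem exists_familyWorks : ∀ m : Fin 5 × Fin 5, ∀ n₀ ∈ candidates m,
      (List.finRange 7).any (familyWorks m n₀) = true := by
  decide +kernel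

end SymbolAlgebra

/-! ### From word sums to the support of the space -/

/-- If a product of two linear forms vanishes on a subspace, one of the forms does. -/
theorem Submodule.forall_eq_zero_or_of_mul_eq_zero {F E : Type*} [Field F] [AddCommGroup E]
    [Module F E] (V : Submodule F E) (f g : E →ₗ[F] F) (h : ∀ v ∈ V, f v * g v = 0) :
    (∀ v ∈ V, f v = 0) ∨ ∀ v ∈ V, g v = 0 := by
  by_contra! hcon
  obtain ⟨⟨v, hv, hfv⟩, w, hw, hgw⟩ := hcon
  have hgv := (mul_eq_zero.1 (h v hv)).resolve_left hfv
  have hfw := (mul_eq_zero.1 (h w hw)).resolve_right hgw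
  have := h (v + w) (V.add_mem hv hw)
  rw [map_add, map_add, hgv, hfw, add_zero, zero_add] at this
  exact (mul_ne_zero hfv hgw) this

namespace SymbolAlgebra

theorem not_mem_of_mem_candidates : ∀ m : Fin 5 × Fin 5, ∀ n ∈ candidates m,
    n ∉ [(1, 0), (0, 1), m] := by
  decide +kernel

variable {F : Type*} [Field F]

/-- A coordinate as a linear form. -/
noncomputable def coordForm {ρ : F} (hρ : ρ ^ 5 = 1) (α β : F) (n : Fin 5 × Fin 5) :
    SymbolAlgebra 5 ρ α β →ₗ[F] F :=
  LinearMap.proj n ∘ₗ coord hρ α β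

theorem letters_eq_add (m n p : Fin 5 × Fin 5) (a b c d e : ℕ) :
    letters m n p a b c d e =
      (Multiset.replicate a (1, 0) + Multiset.replicate b (0, 1) + Multiset.replicate c m) +
        (Multiset.replicate d n + Multiset.replicate e p) := by
  simp [letters, add_assoc]

theorem card_of_mem_triples {N : ℕ} {t : ℕ × ℕ × ℕ} (ht : t ∈ triples N) :
    t.1 + t.2.1 + t.2.2 = N := by
  simp only [triples, List.mem_flatMap, List.mem_map, List.mem_range] at ht
  obtain ⟨a, ha, b, hb, rfl⟩ := ht
  simp
  omega

section

variable [Infinite F] {ρ : F} (hρ : IsPrimitiveRoot ρ 5) {α β : F} (hα : α ≠ 0) (hβ : β ≠ 0)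
  {V : Submodule F (SymbolAlgebra 5 ρ α β)} (hV : IsDCentralSpace 5 V)
  {m : Fin 5 × Fin 5} (hmx : m ≠ (1, 0)) (hmy : m ≠ (0, 1))
  (hx : mono ρ α β (1, 0) ∈ V) (hy : mono ρ α β (0, 1) ∈ V) (hm : mono ρ α β m ∈ V)

include hρ hα hβ hV hmx hmy hx hy hm

theorem prod_coord_eq_zero_of_obstructs {v : SymbolAlgebra 5 ρ α β} (hv : v ∈ V)
    {n p : Fin 5 × Fin 5} {d e : ℕ}
    (hn : n ∉ [(1, 0), (0, 1), m] ∨ d = 0) (hp : p ∉ [(1, 0), (0, 1), m, n] ∨ e = 0)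
    (h : ∃ t : ℕ × ℕ × ℕ, t.1 + t.2.1 + t.2.2 + d + e = 5 ∧ obstructs m n p d e t = true)
    (huniq : ∀ r' : Multiset (Fin 5 × Fin 5),
      (∀ i ∈ r', i ∉ [(1, 0), (0, 1), m] ∧ coord hρ.pow_eq_one α β v i ≠ 0) → r'.card = d + e →
      r'.sum = (Multiset.replicate d n + Multiset.replicate e p).sum →
      r' = Multiset.replicate d n + Multiset.replicate e p) :
    coord hρ.pow_eq_one α β v n ^ d * coord hρ.pow_eq_one α β v p ^ e = 0 := by
  obtain ⟨t, ht, h⟩ := h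
  obtain ⟨h1, h2⟩ := qshuffle_ne_zero_of_obstructs hρ hmx hmy hn hp h
  rw [letters_eq_add] at h1 h2
  have key := prod_mul_qshuffle_eq_zero hρ hα hβ hV {(1, 0), (0, 1), m} ?_ hv
    (Multiset.replicate t.1 (1, 0) + Multiset.replicate t.2.1 (0, 1) + Multiset.replicate t.2.2 m)
    (Multiset.replicate d n + Multiset.replicate e p) ?_ ?_ ?_ h1 ?_
  · simpa using (mul_eq_zero.1 key).resolve_right h2
  · simp only [Finset.mem_insert, Finset.mem_singleton]
    rintro _ (rfl | rfl | rfl) <;> assumption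
  · intro i hi
    simp only [Multiset.mem_add, Multiset.mem_replicate] at hi
    simp only [Finset.mem_insert, Finset.mem_singleton]
    tauto
  · intro i hi
    simp only [Multiset.mem_add, Multiset.mem_replicate] at hi
    simp only [List.mem_cons, List.not_mem_nil, or_false] at hn hp
    simp only [Finset.mem_insert, Finset.mem_singleton]
    rcases hi with ⟨hd, rfl⟩ | ⟨he, rfl⟩
    · exact hn.resolve_right hd
    · have := hp.resolve_right he
      tauto
  · simp only [Multiset.card_add, Multiset.card_replicate]
    omega
  · simpa using huniq

theorem candidates_ne_nil : candidates m ≠ [] := by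
  intro h
  obtain ⟨t, ht, h⟩ := List.any_eq_true.1 (obstructs_of_candidates_eq_nil m hmx hmy h)
  have := prod_coord_eq_zero_of_obstructs hρ hα hβ hV hmx hmy hx hy hm V.zero_mem
    (Or.inr rfl) (Or.inr rfl) ⟨t, by simpa using card_of_mem_triples ht, h⟩ ?_
  · simp at this
  · intro r' _ hr' _
    simpa using hr'

theorem mem_candidates_of_coord_ne_zero {v : SymbolAlgebra 5 ρ α β} (hv : v ∈ V)
    {n : Fin 5 × Fin 5} (hn : coord hρ.pow_eq_one α β v n ≠ 0) :
    n ∈ (1, 0) :: (0, 1) :: m :: candidates m := by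
  have hne := candidates_ne_nil hρ hα hβ hV hmx hmy hx hy hm
  refine (obstructs_of_not_mem_candidates m hne n).elim id fun h => ?_
  by_contra hmem
  obtain ⟨t, ht, h⟩ := List.any_eq_true.1 h
  refine hn ?_
  have := prod_coord_eq_zero_of_obstructs hρ hα hβ hV hmx hmy hx hy hm hv
    (Or.inl ?_) (Or.inr rfl) ⟨t, by simpa using card_of_mem_triples ht, h⟩ ?_
  · simpa using this
  · simp only [List.mem_cons, not_or] at hmem ⊢
    simp [hmem]
  · intro r' _ hr' hs
    obtain ⟨i, rfl⟩ := Multiset.card_eq_one.1 hr'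
    simpa using hs

/-- The linear conditions already confine the support of `v` to `x`, `y`, `m` and the candidates, so
uniqueness of the pair `{n, n'}` with its sum has to be tested among candidates only. -/
theorem coord_mul_coord_eq_zero {v : SymbolAlgebra 5 ρ α β} (hv : v ∈ V)
    {n n' : Fin 5 × Fin 5} (hn : n ∈ candidates m) (hn' : n' ∈ candidates m)
    (h : incompatible m n n' = true) :
    coord hρ.pow_eq_one α β v n * coord hρ.pow_eq_one α β v n' = 0 := by
  rw [incompatible, Bool.and_eq_true] at h
  obtain ⟨h1, h2⟩ := h
  obtain ⟨t, ht, h⟩ := List.any_eq_true.1 h2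
  have huniq : ∀ r' : Multiset (Fin 5 × Fin 5),
      (∀ i ∈ r', i ∉ [(1, 0), (0, 1), m] ∧ coord hρ.pow_eq_one α β v i ≠ 0) → r'.card = 2 →
      r'.sum = n + n' → r' = {n, n'} := by
    intro r' hr hcard hsum
    obtain ⟨p, p', rfl⟩ := Multiset.card_eq_two.1 hcard
    have hmem : ∀ i ∈ ({p, p'} : Multiset (Fin 5 × Fin 5)), i ∈ candidates m := by
      intro i hi
      have h3 := mem_candidates_of_coord_ne_zero hρ hα hβ hV hmx hmy hx hy hm hv (hr i hi).2
      have h4 := (hr i hi).1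
      simp only [List.mem_cons, List.not_mem_nil, or_false, not_or] at h3 h4
      tauto
    have hp : p ∈ candidates m := hmem p (by simp)
    have hp' : p' ∈ candidates m := hmem p' (by simp)
    have h5 := List.all_eq_true.1 (List.all_eq_true.1 h1 p hp) p' hp'
    have h6 : p + p' = n + n' := by simpa using hsum
    simp only [h6, bne_self_eq_false, Bool.false_or, Bool.or_eq_true, Bool.and_eq_true,
      beq_iff_eq] at h5
    rcases h5 with ⟨rfl, rfl⟩ | ⟨rfl, rfl⟩
    · rfl
    · exact Multiset.pair_comm _ _
  have hn1 := not_mem_of_mem_candidates m n hn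
  have hn2 := not_mem_of_mem_candidates m n' hn'
  have ht' := card_of_mem_triples ht
  by_cases hnn : n = n'
  · subst hnn
    rw [if_pos rfl] at h
    have := prod_coord_eq_zero_of_obstructs hρ hα hβ hV hmx hmy hx hy hm hv
      (Or.inl hn1) (Or.inr rfl) ⟨t, by omega, h⟩ ?_
    · simpa [pow_two] using this
    · intro r' h1 h2 h3
      rw [huniq r' h1 h2 (by simpa [two_mul, Multiset.replicate_succ] using h3)]
      rfl
  · rw [if_neg hnn] at h
    have := prod_coord_eq_zero_of_obstructs hρ hα hβ hV hmx hmy hx hy hm hv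
      (Or.inl hn1) (Or.inl ?_) ⟨t, by omega, h⟩ ?_
    · simpa using this
    · have h0 : n' ≠ n := fun h => hnn h.symm
      simp only [List.mem_cons, not_or] at hn2 ⊢
      simp [hn2, h0]
    · intro r' h1 h2 h3
      rw [huniq r' h1 h2 (by simpa using h3)]
      rfl

/-- All elements of `V` are supported on a single family of monomials. -/
theorem exists_family (hdim : 4 ≤ Module.finrank F V) :
    ∃ t : Fin 7, family t (1, 0) = true ∧ family t (0, 1) = true ∧ family t m = true ∧
      (t = 6 → m.1 + m.2 = 1) ∧
      ∀ v ∈ V, ∀ n, coord hρ.pow_eq_one α β v n ≠ 0 → family t n = true := by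
  obtain ⟨n₀, hn₀, v₀, hv₀, h₀⟩ :
      ∃ n₀ ∈ candidates m, ∃ v ∈ V, coord hρ.pow_eq_one α β v n₀ ≠ 0 := by
    by_contra! hcon
    -- If no candidate occurred, `V` would be spanned by `x`, `y` and `m`, against `dim V ≥ 4`.
    have hle : V ≤ Submodule.span F
        (Set.range ![mono ρ α β (1, 0), mono ρ α β (0, 1), mono ρ α β m]) := by
      intro v hv
      rw [← sum_coord hρ.pow_eq_one hα hβ v]
      refine Submodule.sum_mem _ fun n _ => ?_
      by_cases h0 : coord hρ.pow_eq_one α β v n = 0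
      · simp [h0]
      refine Submodule.smul_mem _ _ (Submodule.subset_span ?_)
      have := mem_candidates_of_coord_ne_zero hρ hα hβ hV hmx hmy hx hy hm hv h0
      simp only [List.mem_cons] at this
      rcases this with rfl | rfl | rfl | h
      · exact ⟨0, rfl⟩
      · exact ⟨1, rfl⟩
      · exact ⟨2, rfl⟩
      · exact absurd (hcon n h v hv) h0
    have := Module.Finite.span_of_finite F (Set.finite_range
      ![mono ρ α β (1, 0), mono ρ α β (0, 1), mono ρ α β m])
    have h1 := Submodule.finrank_mono hle
    have h2 := finrank_range_le_card (R := F)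
      ![mono ρ α β (1, 0), mono ρ α β (0, 1), mono ρ α β m]
    rw [Set.finrank, Fintype.card_fin] at h2
    omega
  obtain ⟨t, -, ht⟩ := List.any_eq_true.1 (exists_familyWorks m n₀ hn₀)
  simp only [familyWorks, Bool.and_eq_true, Bool.or_eq_true, bne_iff_ne, beq_iff_eq,
    List.all_eq_true] at ht
  obtain ⟨⟨⟨⟨⟨t1, t2⟩, t3⟩, t4⟩, -⟩, t5⟩ := ht
  refine ⟨t, t1, t2, t3, fun h => t4.resolve_left (not_not.2 h), fun v hv n hn => ?_⟩
  have hmem := mem_candidates_of_coord_ne_zero hρ hα hβ hV hmx hmy hx hy hm hv hn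
  simp only [List.mem_cons] at hmem
  rcases hmem with rfl | rfl | rfl | hmem
  · exact t1
  · exact t2
  · exact t3
  rcases t5 n hmem with (h | h) | h
  · exact h
  -- The coordinate at `n₀` is nonzero at `v₀`, so the coordinate at `n` vanishes on all of `V`, and
  -- not just at vectors that involve `n₀`.
  · rcases V.forall_eq_zero_or_of_mul_eq_zero (coordForm hρ.pow_eq_one α β n₀)
      (coordForm hρ.pow_eq_one α β n) (fun w hw =>
        coord_mul_coord_eq_zero hρ hα hβ hV hmx hmy hx hy hm hw hn₀ hmem h) with h' | h'
    · exact absurd (h' v₀ hv₀) h₀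
    · exact absurd (h' v hv) hn
  · have := coord_mul_coord_eq_zero hρ hα hβ hV hmx hmy hx hy hm hv hmem hmem h
    exact absurd (mul_self_eq_zero.1 this) hn

end
end SymbolAlgebra

/-! ### Averaging over roots of unity and the `q`-binomial formula -/

open Polynomial in
theorem SemiconjBy.aeval {F A : Type*} [CommSemiring F] [Semiring A] [Algebra F A] {z u u' : A}
    (h : SemiconjBy z u u') (p : F[X]) : SemiconjBy z (aeval u p) (aeval u' p) := by
  induction p using Polynomial.induction_on' with
  | add p q hp hq => simpa using hp.add_right hq
  | monomial n c =>
    simp only [aeval_monomial]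
    exact (SemiconjBy.mul_right (Algebra.commutes c z).symm (h.pow_right n))

/-- The expansion of `(s x + g) ^ n` in powers of a central `s`. -/
theorem exists_smul_add_pow_eq {F A : Type*} [CommRing F] [Ring A] [Algebra F A] (x g : A)
    (n : ℕ) : ∃ T : ℕ → A, T 0 = g ^ n ∧ T n = x ^ n ∧
      ∀ s : F, (s • x + g) ^ n = ∑ l ∈ Finset.range (n + 1), s ^ l • T l := by
  suffices h : ∃ T : ℕ → A, T 0 = g ^ n ∧ T n = x ^ n ∧ (∀ l, n < l → T l = 0) ∧
      ∀ s : F, (s • x + g) ^ n = ∑ l ∈ Finset.range (n + 1), s ^ l • T l by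
    obtain ⟨T, h1, h2, -, h3⟩ := h
    exact ⟨T, h1, h2, h3⟩
  induction n with
  | zero => exact ⟨fun l => if l = 0 then 1 else 0, by simp, by simp,
      fun l hl => by simp [hl.ne'], by simp⟩
  | succ n ih =>
    obtain ⟨T, h1, h2, h3, h4⟩ := ih
    -- Noncommutative Pascal rule; the case `l = 0` guards against the truncated `l - 1`.
    refine ⟨fun l => (if l = 0 then 0 else x * T (l - 1)) + g * T l, ?_, ?_, ?_, ?_⟩
    · simp [h1, pow_succ']
    · simp [h2, h3, pow_succ']
    · intro l hl
      simp [h3 l (by omega), h3 (l - 1) (by omega)]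
    · intro s
      rw [pow_succ', h4, add_mul, Finset.mul_sum, Finset.mul_sum]
      simp_rw [smul_add]
      rw [Finset.sum_add_distrib]
      congr 1
      · rw [Finset.sum_range_succ' _ (n + 1)]
        simp only [Nat.succ_ne_zero, if_false, if_true, smul_zero, add_zero, Nat.add_sub_cancel]
        refine Finset.sum_congr rfl fun l _ => ?_
        rw [smul_mul_assoc, mul_smul_comm, smul_smul, pow_succ']
      · rw [Finset.sum_range_succ _ (n + 1), h3 (n + 1) (by omega)]
        simp

section Average

variable {F A : Type*} [Field F] [Ring A] [Algebra F A] {r : F}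

theorem IsPrimitiveRoot.sum_pow_pow_five (hr : IsPrimitiveRoot r 5) {l : ℕ} (hl : ¬ 5 ∣ l) :
    ∑ j ∈ Finset.range 5, (r ^ l) ^ j = 0 := by
  have hp : IsPrimitiveRoot (r ^ l) 5 :=
    hr.pow_of_coprime l ((Nat.Prime.coprime_iff_not_dvd (by norm_num)).2 hl).symm
  exact hp.geom_sum_eq_zero (by norm_num)

theorem IsPrimitiveRoot.five_ne_zero (hr : IsPrimitiveRoot r 5) : (5 : F) ≠ 0 := by
  have : NeZero ((5 : ℕ) : F) := hr.neZero'
  exact_mod_cast this.out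

theorem pow_eq_zero_of_average (hr : IsPrimitiveRoot r 5) {x g u : A} {k : ℕ} (hk : 1 ≤ k)
    (hk' : k < 5) (h : ∀ j < 5, (r ^ j • x + g) ^ k = u) : x ^ k = 0 := by
  obtain ⟨T, -, h2, h3⟩ := exists_smul_add_pow_eq (F := F) x g k
  -- The weight isolates the top term: for `l ≤ k < 5`, the number `5 - k + l` is divisible by `5`
  -- only when `l = k`.
  have h4 : ∑ j ∈ Finset.range 5, (r ^ (5 - k)) ^ j • (r ^ j • x + g) ^ k = 0 := by
    rw [Finset.sum_congr rfl fun j hj => by rw [h j (Finset.mem_range.1 hj)], ← Finset.sum_smul,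
      hr.sum_pow_pow_five (by omega), zero_smul]
  simp_rw [h3, Finset.smul_sum, smul_smul] at h4
  rw [Finset.sum_comm] at h4
  have h5 : ∀ l ∈ Finset.range (k + 1), l ≠ k →
      ∑ j ∈ Finset.range 5, ((r ^ (5 - k)) ^ j * (r ^ j) ^ l) • T l = 0 := by
    intro l hl hlk
    rw [Finset.mem_range] at hl
    rw [← Finset.sum_smul, Finset.sum_congr rfl (g := fun j => (r ^ (5 - k + l)) ^ j) fun j _ => by
      ring, hr.sum_pow_pow_five (by omega), zero_smul]
  rw [Finset.sum_eq_single k h5 (by simp), ← Finset.sum_smul,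
    Finset.sum_congr rfl (g := fun _ => (1 : F)) fun j _ => by
      rw [← pow_mul, ← pow_mul, ← pow_add, mul_comm, ← mul_add, mul_comm, pow_mul,
        show 5 - k + k = 5 by omega, hr.pow_eq_one, one_pow], h2] at h4
  simpa [hr.five_ne_zero] using h4

/-- Summing over `j` kills every degree in `x` except `0` and `5`. -/
theorem eq_add_of_average (hr : IsPrimitiveRoot r 5) {x g u : A}
    (h : ∀ j < 5, (r ^ j • x + g) ^ 5 = u) : u = x ^ 5 + g ^ 5 := by
  obtain ⟨T, h1, h2, h3⟩ := exists_smul_add_pow_eq (F := F) x g 5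
  have h4 : ∑ j ∈ Finset.range 5, (r ^ j • x + g) ^ 5 = (5 : F) • u := by
    rw [Finset.sum_congr rfl fun j hj => h j (Finset.mem_range.1 hj)]
    simp [← Nat.cast_smul_eq_nsmul F]
  have h5 : ∀ l, ¬ 5 ∣ l → ∑ j ∈ Finset.range 5, (r ^ j) ^ l • T l = 0 := by
    intro l hl
    rw [← Finset.sum_smul, Finset.sum_congr rfl (g := fun j => (r ^ l) ^ j) fun j _ => by
      ring, hr.sum_pow_pow_five hl, zero_smul]
  simp_rw [h3] at h4
  have h6 : ∀ j : ℕ, (r ^ j) ^ 5 = 1 := fun j => by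
    rw [← pow_mul, mul_comm, pow_mul, hr.pow_eq_one, one_pow]
  rw [Finset.sum_comm, Finset.sum_range_succ, Finset.sum_range_succ',
    Finset.sum_eq_zero fun l hl => h5 (l + 1) (by rw [Finset.mem_range] at hl; omega)] at h4
  simp only [pow_zero, h6, one_smul, Finset.sum_const, Finset.card_range, h1, h2, zero_add,
    ← smul_add, ← Nat.cast_smul_eq_nsmul F] at h4
  rw [add_comm, ← sub_eq_zero]
  have h7 : (5 : F) • (u - (g ^ 5 + x ^ 5)) = 0 := by
    rw [smul_sub, ← h4]
    simp
  exact (smul_eq_zero.1 h7).resolve_left hr.five_ne_zero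

end Average

/-- The `q`-binomial formula for a primitive fifth root of unity. -/
theorem add_pow_five_of_qcomm {F A : Type*} [Field F] [Ring A] [Algebra F A] {Q : F}
    (hQ : IsPrimitiveRoot Q 5) {g x : A} (h : x * g = Q • (g * x)) :
    (g + x) ^ 5 = g ^ 5 + x ^ 5 := by
  have hg := hQ.geom_sum_eq_zero (by norm_num)
  simp only [Finset.sum_range_succ, Finset.sum_range_zero] at hg
  have hx : ∀ k j : ℕ, x * (g ^ k * x ^ j) = Q ^ k • (g ^ k * x ^ (j + 1)) := by
    intro k j
    have := SymbolAlgebra.qcomm_monomial_mul h 0 1 k j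
    simpa [add_comm] using this
  have hgk : ∀ k j : ℕ, g * (g ^ k * x ^ j) = g ^ (k + 1) * x ^ j := fun k j => by
    rw [← mul_assoc, ← pow_succ']
  have h1 : (g + x) = g ^ 1 * x ^ 0 + g ^ 0 * x ^ 1 := by simp
  have h2 : (g + x) ^ 2 = g ^ 2 * x ^ 0 + (1 + Q) • (g ^ 1 * x ^ 1) + g ^ 0 * x ^ 2 := by
    rw [pow_succ', pow_one]
    nth_rewrite 2 [h1]
    simp only [add_mul, mul_add, hx, hgk, zero_add, Nat.reduceAdd]
    module
  have h3 : (g + x) ^ 3 = g ^ 3 * x ^ 0 + (1 + Q + Q ^ 2) • (g ^ 2 * x ^ 1) +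
      (1 + Q + Q ^ 2) • (g ^ 1 * x ^ 2) + g ^ 0 * x ^ 3 := by
    rw [pow_succ', h2]
    simp only [add_mul, mul_add, mul_smul_comm, hx, hgk, zero_add, Nat.reduceAdd]
    module
  have h4 : (g + x) ^ 4 = g ^ 4 * x ^ 0 + (1 + Q + Q ^ 2 + Q ^ 3) • (g ^ 3 * x ^ 1) +
      ((1 + Q + Q ^ 2) * (1 + Q ^ 2)) • (g ^ 2 * x ^ 2) +
      (1 + Q + Q ^ 2 + Q ^ 3) • (g ^ 1 * x ^ 3) + g ^ 0 * x ^ 4 := by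
    rw [pow_succ', h3]
    simp only [add_mul, mul_add, mul_smul_comm, hx, hgk, zero_add, Nat.reduceAdd]
    module
  have h5 : (g + x) ^ 5 = g ^ 5 * x ^ 0 +
      (1 + Q + Q ^ 2 + Q ^ 3 + Q ^ 4) • (g ^ 4 * x ^ 1 + (1 + Q ^ 2) • (g ^ 3 * x ^ 2) +
        (1 + Q ^ 2) • (g ^ 2 * x ^ 3) + g ^ 1 * x ^ 4) + g ^ 0 * x ^ 5 := by
    rw [pow_succ', h4]
    simp only [add_mul, mul_add, mul_smul_comm, hx, hgk, zero_add, Nat.reduceAdd]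
    module
  rw [h5]
  have : 1 + Q + Q ^ 2 + Q ^ 3 + Q ^ 4 = 0 := by linear_combination hg
  simp [this]

section

open Polynomial

theorem Polynomial.aeval_comp_C_mul_X {F A : Type*} [CommSemiring F] [Semiring A] [Algebra F A]
    (w : A) (p : F[X]) (s : F) : aeval w (p.comp (C s * X)) = aeval (s • w) p := by
  rw [Polynomial.aeval_comp]
  simp [Algebra.smul_def]

/-! ### Pairs generating a symbol algebra and the standard spaces -/

section Pair

variable {F A : Type*} [Field F] [Ring A] [Algebra F A]

/-- Elements generating a symbol algebra of degree five. -/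
structure SymbolPair (q a b : F) (w z : A) : Prop where
  prim : IsPrimitiveRoot q 5
  left_ne : a ≠ 0
  right_ne : b ≠ 0
  left_pow : w ^ 5 = algebraMap F A a
  right_pow : z ^ 5 = algebraMap F A b
  mul_comm : z * w = q • (w * z)
  mem_center : ∀ u : A, Commute w u → Commute z u → u ∈ Set.center A

namespace SymbolPair

variable {q a b : F} {w z : A} (h : SymbolPair q a b w z)

include h

theorem isUnit_left : IsUnit w := by
  rw [← isUnit_pow_iff (n := 5) (by norm_num), h.left_pow]
  exact (IsUnit.mk0 a h.left_ne).map _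

theorem isUnit_right : IsUnit z := by
  rw [← isUnit_pow_iff (n := 5) (by norm_num), h.right_pow]
  exact (IsUnit.mk0 b h.right_ne).map _

theorem semiconj_pow (n : ℕ) : SemiconjBy (z ^ n) w (q ^ n • w) := by
  have := SymbolAlgebra.qcomm_pow_pow h.mul_comm 1 n
  rw [SemiconjBy, smul_mul_assoc]
  simpa using this

theorem aeval_mul_pow (p : F[X]) (n : ℕ) :
    (aeval w p * z) ^ n =
      aeval w (∏ k ∈ Finset.range n, p.comp (C (q ^ k) * X)) * z ^ n := by
  induction n with
  | zero => simp
  | succ n ih =>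
    rw [pow_succ, ih, Finset.prod_range_succ, map_mul, aeval_comp_C_mul_X, mul_assoc,
      ← mul_assoc (z ^ n), ((h.semiconj_pow n).aeval p).eq, pow_succ]
    simp only [mul_assoc]

theorem semiconj_left (j : ℕ) (p g : F[X]) :
    SemiconjBy (w ^ j) (aeval w p * z + aeval w g)
      (q⁻¹ ^ j • (aeval w p * z) + aeval w g) := by
  have hc : ∀ p : F[X], w ^ j * aeval w p = aeval w p * w ^ j := fun p => by
    have : w ^ j = aeval w (X ^ j : F[X]) := by simp
    rw [this, ← map_mul, ← map_mul, _root_.mul_comm]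
  have hz : w ^ j * z = q⁻¹ ^ j • (z * w ^ j) := by
    have := SymbolAlgebra.qcomm_pow_pow h.mul_comm j 1
    rw [pow_one, one_mul] at this
    rw [this, smul_smul, ← mul_pow, inv_mul_cancel₀ (h.prim.ne_zero (by norm_num)), one_pow,
      one_smul]
  refine SemiconjBy.add_right ?_ (hc g)
  rw [SemiconjBy, ← mul_assoc, hc, mul_assoc, hz, mul_smul_comm, smul_mul_assoc, mul_assoc]

/-- Conjugation by `w ^ j` fixes a central element, while it fixes `g(w)` and scales `p(w) z`. This
is the input for the averaging lemmas. -/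
theorem pow_eq_of_mem_center (p g : F[X]) (k : ℕ)
    (hc : (aeval w p * z + aeval w g) ^ k ∈ Set.center A) (j : ℕ) :
    (q⁻¹ ^ j • (aeval w p * z) + aeval w g) ^ k = (aeval w p * z + aeval w g) ^ k := by
  have h1 := ((h.semiconj_left j p g).pow_right k).eq
  rw [(Semigroup.mem_center_iff.1 hc) (w ^ j)] at h1
  exact ((h.isUnit_left.pow j).mul_left_inj.1 h1).symm

/-- Up to the scalar `z ^ 5`, the fifth power is the norm `∏ p(q ^ k w)`, whose factors are permuted
by `w ↦ q w`. -/
theorem commute_right_pow_five (p : F[X]) : Commute z ((aeval w p * z) ^ 5) := by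
  have h1 : (∏ k ∈ Finset.range 5, p.comp (C (q ^ k) * X)).comp (C q * X) =
      ∏ k ∈ Finset.range 5, p.comp (C (q ^ k) * X) := by
    rw [Polynomial.prod_comp]
    have h2 : ∀ k, (p.comp (C (q ^ k) * X)).comp (C q * X) = p.comp (C (q ^ (k + 1)) * X) := by
      intro k
      rw [comp_assoc]
      congr 1
      simp [pow_succ, mul_assoc]
    simp_rw [h2]
    rw [Finset.prod_range_succ _ 4, h.prim.pow_eq_one,
      Finset.prod_range_succ' (fun k => p.comp (C (q ^ k) * X)) 4, pow_zero]
  rw [h.aeval_mul_pow, h.right_pow]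
  refine Commute.mul_right ?_ (Algebra.commutes b z).symm
  have h3 := (h.semiconj_pow 1).aeval (∏ k ∈ Finset.range 5, p.comp (C (q ^ k) * X))
  rwa [pow_one, pow_one, ← aeval_comp_C_mul_X, h1] at h3

theorem commute_left_pow_five (p : F[X]) : Commute w ((aeval w p * z) ^ 5) := by
  rw [h.aeval_mul_pow, h.right_pow]
  refine Commute.mul_right ?_ (Algebra.commutes b w).symm
  have := (Commute.all (X : F[X]) (∏ k ∈ Finset.range 5, p.comp (C (q ^ k) * X))).map (aeval w)
  rwa [aeval_X] at this

end SymbolPair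
end Pair

theorem exists_of_mem_adjoinMulAddSpan {F A : Type*} [Field F] [Ring A] [Algebra F A]
    {w z u v : A} (hv : v ∈ adjoinMulAddSpan F w z u) :
    ∃ (p : F[X]) (c : F), v = aeval w p * z + c • u := by
  obtain ⟨s, hs, t, ht, rfl⟩ := Submodule.mem_sup.1 hv
  obtain ⟨r, hr, rfl⟩ := Submodule.mem_map.1 hs
  rw [Subalgebra.mem_toSubmodule, Algebra.adjoin_singleton_eq_range_aeval] at hr
  obtain ⟨p, rfl⟩ := hr
  obtain ⟨c, rfl⟩ := Submodule.mem_span_singleton.1 ht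
  exact ⟨p, c, rfl⟩

theorem mem_adjoinMulAddSpan {F A : Type*} [Field F] [Ring A] [Algebra F A]
    (w z u : A) (p : F[X]) (c : F) : aeval w p * z + c • u ∈ adjoinMulAddSpan F w z u :=
  Submodule.add_mem_sup ⟨_, aeval_mem_adjoin_singleton F w, rfl⟩
    (Submodule.smul_mem _ _ (Submodule.mem_span_singleton_self u))

namespace SymbolPair

variable {F A : Type*} [Field F] [Ring A] [Algebra F A] {q a b : F} {w z : A}
  (h : SymbolPair q a b w z)

include h

theorem aeval_left_eq_zero : aeval w (X ^ 5 - C a : F[X]) = 0 := by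
  simp [h.left_pow]

/-- A polynomial vanishing at `c` and `q c`, where `c ^ 5 = a`, gives a nilpotent element. -/
theorem pow_four_eq_zero {c : F} (hc : c ^ 5 = a) {p : F[X]} (h0 : p.eval c = 0)
    (h1 : p.eval (q * c) = 0) : (aeval w p * z) ^ 4 = 0 := by
  have hc0 : c ≠ 0 := by
    rintro rfl
    exact h.left_ne (by rw [← hc]; norm_num)
  -- The roots of `X ^ 5 - a` are the `q ^ i c`. Two consecutive zeros of `p` let four shifts,
  -- rather than five, reach all of them.
  have hdvd : X ^ 5 - C a ∣ ∏ k ∈ Finset.range 4, p.comp (C (q ^ k) * X) := by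
    rw [X_pow_sub_C_eq_prod h.prim (by norm_num) hc]
    refine Finset.prod_dvd_of_coprime ?_ ?_
    · intro i hi j hj hij
      refine (pairwise_coprime_X_sub_C (K := F) (s := fun i : Fin 5 => q ^ (i : ℕ) * c) ?_)
        (i := ⟨i, by simpa using hi⟩) (j := ⟨j, by simpa using hj⟩) (by simpa using hij)
      intro i j hij
      exact Fin.ext (h.prim.pow_inj i.2 j.2 (mul_right_cancel₀ hc0 hij))
    · intro i hi
      rw [dvd_iff_isRoot, IsRoot, eval_prod]
      have key : ∃ k ∈ Finset.range 4, (q ^ k * (q ^ i * c) = c ∨ q ^ k * (q ^ i * c) = q * c) := by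
        have h5 := h.prim.pow_eq_one
        have hi' : i < 5 := Finset.mem_range.1 hi
        interval_cases i
        · exact ⟨0, by simp, Or.inl (by ring)⟩
        · exact ⟨0, by simp, Or.inr (by ring)⟩
        · exact ⟨3, by simp, Or.inl (by linear_combination c * h5)⟩
        · exact ⟨2, by simp, Or.inl (by linear_combination c * h5)⟩
        · exact ⟨1, by simp, Or.inl (by linear_combination c * h5)⟩
      obtain ⟨k, hk, hk'⟩ := key
      refine Finset.prod_eq_zero hk ?_
      rw [eval_comp]
      simp only [eval_mul, eval_C, eval_X]
      rcases hk' with hk' | hk' <;> rw [hk'] <;> assumption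
  obtain ⟨r, hr⟩ := hdvd
  rw [h.aeval_mul_pow, hr, map_mul, h.aeval_left_eq_zero, zero_mul, zero_mul]

/-- Vanishing at `c` and at `q c` is two linear conditions, so a three-dimensional space has a
nonzero element satisfying both. Its fourth power is `0`, which is central. -/
theorem pow_ne_of_linearIndependent {V : Submodule F A} (hV : IsDCentralSpace 5 V)
    (u : Fin 3 → A) (hu : LinearIndependent F u) (huV : ∀ i, u i ∈ V)
    (hp : ∀ i, ∃ p : F[X], u i = aeval w p * z) (c : F) : c ^ 5 ≠ a := by
  intro hc
  choose p hp using hp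
  let L : (Fin 3 → F) →ₗ[F] (Fin 2 → F) :=
    LinearMap.pi ![∑ i, (p i).eval c • LinearMap.proj i, ∑ i, (p i).eval (q * c) • LinearMap.proj i]
  obtain ⟨t, ht, ht0⟩ := L.ker.ne_bot_iff.1 (LinearMap.ker_ne_bot_of_finrank_lt (by simp))
  have e0 := congrFun (LinearMap.mem_ker.1 ht) 0
  have e1 := congrFun (LinearMap.mem_ker.1 ht) 1
  simp only [L, LinearMap.pi_apply, Matrix.cons_val_zero, Matrix.cons_val_one,
    LinearMap.sum_apply, LinearMap.smul_apply, LinearMap.proj_apply, smul_eq_mul, Pi.zero_apply]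
    at e0 e1
  have hv : ∑ i, t i • u i = aeval w (∑ i, t i • p i) * z := by
    simp [hp, Finset.sum_mul]
  have hv0 : ∑ i, t i • u i ≠ 0 := by
    intro h0
    exact ht0 (funext (Fintype.linearIndependent_iff.1 hu t h0))
  have hmem : ∑ i, t i • u i ∈ V := V.sum_mem fun i _ => V.smul_mem _ (huV i)
  refine (hV _ hmem hv0).2.2 4 (by norm_num) (by norm_num) ?_
  rw [hv, h.pow_four_eq_zero hc]
  · exact Set.zero_mem_center
  · simp only [eval_finsetSum, eval_smul, smul_eq_mul]
    rw [← e0]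
    exact Finset.sum_congr rfl fun _ _ => _root_.mul_comm _ _
  · simp only [eval_finsetSum, eval_smul, smul_eq_mul]
    rw [← e1]
    exact Finset.sum_congr rfl fun _ _ => _root_.mul_comm _ _

section Domain

variable (ha : ∀ c : F, c ^ 5 ≠ a) [Nontrivial A]

include ha

theorem minpoly_eq : minpoly F w = X ^ 5 - C a :=
  (minpoly.eq_of_irreducible_of_monic (X_pow_sub_C_irreducible_of_prime Nat.prime_five ha) h.aeval_left_eq_zero
    (monic_X_pow_sub_C a (by norm_num))).symm

theorem aeval_eq_zero_iff {p : F[X]} : aeval w p = 0 ↔ X ^ 5 - C a ∣ p := by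
  rw [← h.minpoly_eq ha, minpoly.dvd_iff]

theorem aeval_prod_eq_zero {ι : Type*} {s : Finset ι} {p : ι → F[X]}
    (h0 : aeval w (∏ i ∈ s, p i) = 0) : ∃ i ∈ s, aeval w (p i) = 0 := by
  rw [h.aeval_eq_zero_iff ha, (X_pow_sub_C_irreducible_of_prime Nat.prime_five ha).prime.dvd_finsetProd_iff] at h0
  obtain ⟨i, hi, h0⟩ := h0
  exact ⟨i, hi, (h.aeval_eq_zero_iff ha).2 h0⟩

theorem eq_zero_of_natDegree_lt {p : F[X]} (hp : p.natDegree < 5) (h0 : aeval w p = 0) :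
    p = 0 := by
  rw [h.aeval_eq_zero_iff ha] at h0
  by_contra hne
  have := natDegree_le_of_dvd h0 hne
  rw [natDegree_X_pow_sub_C] at this
  omega

/-- `F[w]` is a domain and `z` is invertible, so a vanishing power would force some conjugate `p(q ^
k w)` of `p(w)` to vanish. -/
theorem aeval_mul_pow_ne_zero {p : F[X]} (hp : aeval w p ≠ 0) (n : ℕ) :
    (aeval w p * z) ^ n ≠ 0 := by
  rw [h.aeval_mul_pow]
  intro h0
  rw [(h.isUnit_right.pow n).mul_left_eq_zero] at h0
  obtain ⟨k, -, hk⟩ := h.aeval_prod_eq_zero ha h0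
  rw [aeval_comp_C_mul_X] at hk
  have h1 := ((h.semiconj_pow k).aeval p).eq
  rw [hk, zero_mul, (h.isUnit_right.pow k).mul_right_eq_zero] at h1
  exact hp h1

/-- If `p(w) z + g(w)` has central fifth power, then `g` is a monomial. -/
theorem exists_coeff_eq_zero {p g : F[X]} (hg : g.natDegree < 5)
    (hc : (aeval w p * z + aeval w g) ^ 5 ∈ Set.center A) :
    ∃ k, ∀ i < 5, i ≠ k → g.coeff i = 0 := by
  have hinv : IsPrimitiveRoot q⁻¹ 5 := h.prim.inv
  have h1 := eq_add_of_average hinv fun j _ => h.pow_eq_of_mem_center p g 5 hc j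
  have h2 : Commute z (aeval w g ^ 5) := by
    have h3 : Commute z ((aeval w p * z) ^ 5 + aeval w g ^ 5) := by
      rw [← h1]
      exact Semigroup.mem_center_iff.1 hc z
    simpa using h3.sub_right (h.commute_right_pow_five p)
  have h3 : SemiconjBy z (aeval w g ^ 5) (aeval (q • w) g ^ 5) := by
    have := (h.semiconj_pow 1).aeval g
    rw [pow_one, pow_one] at this
    exact this.pow_right 5
  have h4 : aeval (q • w) g ^ 5 - aeval w g ^ 5 = 0 := by
    rw [sub_eq_zero, ← h.isUnit_right.mul_left_inj, ← h3.eq, h2.eq]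
  rw [← aeval_comp_C_mul_X, ← map_pow, ← map_pow, ← map_sub,
    (h.prim.map_of_injective C_injective).pow_sub_pow_eq_prod_sub_mul _ _ (by norm_num)] at h4
  -- From `g(q w) ^ 5 = g(w) ^ 5` in a domain, `g(q w) = q ^ k g(w)` for some `k`; comparing
  -- coefficients leaves only degree `k`.
  obtain ⟨ζ, hζ, h5⟩ := h.aeval_prod_eq_zero ha h4
  rw [mem_nthRootsFinset (by norm_num)] at hζ
  obtain ⟨k, hk, rfl⟩ := (h.prim.map_of_injective C_injective).eq_pow_of_pow_eq_one hζ
  have h6 := h.eq_zero_of_natDegree_lt ha (lt_of_le_of_lt (natDegree_sub_le _ _) ?_) h5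
  · refine ⟨k, fun i hi hik => ?_⟩
    have h7 := congrArg (fun f => coeff f i) h6
    simp only [coeff_sub, comp_C_mul_X_coeff, ← C_pow, coeff_C_mul, coeff_zero] at h7
    have h8 : g.coeff i * (q ^ i - q ^ k) = 0 := by linear_combination h7
    exact (mul_eq_zero.1 h8).resolve_right
      (sub_ne_zero.2 fun h9 => hik (h.prim.pow_inj hi hk h9))
  · refine max_lt ?_ ?_
    · rw [natDegree_comp]
      rwa [natDegree_C_mul_X q (h.prim.ne_zero (by norm_num)), mul_one]
    · rw [← C_pow]
      exact lt_of_le_of_lt (natDegree_C_mul_le _ _) hg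

/-- The space `F[w] z + F w ^ i` is `5`-central. -/
theorem isDCentralSpace {i : ℕ} (hi : ¬ 5 ∣ i) :
    IsDCentralSpace 5 (adjoinMulAddSpan F w z (w ^ i)) := by
  intro v hv hv0
  obtain ⟨p, c, rfl⟩ := exists_of_mem_adjoinMulAddSpan hv
  have hg : c • w ^ i = aeval w (C c * X ^ i : F[X]) := by simp [Algebra.smul_def]
  have hnc : ∀ k : ℕ, 1 ≤ k → k < 5 → (aeval w p * z + c • w ^ i) ^ k ∉ Set.center A := by
    intro k hk hk' hmem
    by_cases hp : aeval w p = 0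
    · rw [hp, zero_mul, zero_add] at hmem hv0
      have hc : c ≠ 0 := by
        rintro rfl
        simp at hv0
      have h1 := Semigroup.mem_center_iff.1 hmem z
      have h2 := SymbolAlgebra.qcomm_pow_pow h.mul_comm (i * k) 1
      rw [pow_one, one_mul] at h2
      rw [_root_.smul_pow, ← pow_mul, mul_smul_comm, h2, smul_mul_assoc, smul_smul, ← sub_eq_zero,
        ← sub_smul, smul_eq_zero, (h.isUnit_left.pow _).mul_right_eq_zero] at h1
      have hz := h.isUnit_right.ne_zero
      have h3 := h1.resolve_right hz
      rw [← mul_sub_one, mul_eq_zero, sub_eq_zero, h.prim.pow_eq_one_iff_dvd] at h3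
      have h4 := h3.resolve_left (pow_ne_zero k hc)
      rcases (Nat.Prime.dvd_mul Nat.prime_five).1 h4 with h5 | h5
      · exact hi h5
      · exact absurd (Nat.le_of_dvd hk h5) (by omega)
    · rw [hg] at hmem
      exact h.aeval_mul_pow_ne_zero ha hp k
        (pow_eq_zero_of_average h.prim.inv hk hk' fun j _ => h.pow_eq_of_mem_center p _ k hmem j)
  refine ⟨by simpa using hnc 1 le_rfl (by norm_num), ?_, hnc⟩
  have hq : IsPrimitiveRoot (q ^ i) 5 :=
    h.prim.pow_of_coprime i (Nat.Coprime.symm ((Nat.Prime.coprime_iff_not_dvd Nat.prime_five).2 hi))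
  have hcomm : (aeval w p * z) * (c • w ^ i) = q ^ i • ((c • w ^ i) * (aeval w p * z)) := by
    have h2 := SymbolAlgebra.qcomm_pow_pow h.mul_comm i 1
    rw [pow_one, one_mul] at h2
    have h3 : w ^ i * aeval w p = aeval w p * w ^ i := by
      have : w ^ i = aeval w (X ^ i : F[X]) := by simp
      rw [this, ← map_mul, ← map_mul, _root_.mul_comm]
    rw [mul_smul_comm, mul_assoc, h2, smul_mul_assoc, ← mul_assoc, h3, mul_smul_comm, mul_assoc,
      smul_smul, smul_smul, _root_.mul_comm c]
  rw [add_comm, add_pow_five_of_qcomm hq hcomm, _root_.smul_pow, ← pow_mul, _root_.mul_comm i,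
    pow_mul, h.left_pow, ← map_pow]
  refine Set.add_mem_center ?_ (h.mem_center _ (h.commute_left_pow_five p)
    (h.commute_right_pow_five p))
  rw [Semigroup.mem_center_iff]
  intro u
  rw [mul_smul_comm, smul_mul_assoc, Algebra.commutes]

theorem finrank_adjoin : Module.finrank F (Subalgebra.toSubmodule (Algebra.adjoin F {w})) = 5 := by
  have h1 : Subalgebra.toSubmodule (Algebra.adjoin F {w}) =
      Submodule.span F (Set.range fun i : Fin (minpoly F w).natDegree => w ^ (i : ℕ)) := by
    refine le_antisymm ?_ (Submodule.span_le.2 ?_)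
    · intro u hu
      rw [Subalgebra.mem_toSubmodule, Algebra.adjoin_singleton_eq_range_aeval] at hu
      obtain ⟨p, rfl⟩ := hu
      have hmonic : (minpoly F w).Monic := by
        rw [h.minpoly_eq ha]
        exact monic_X_pow_sub_C a (by norm_num)
      have hne : minpoly F w ≠ 1 := by
        rw [h.minpoly_eq ha]
        exact (X_pow_sub_C_irreducible_of_prime Nat.prime_five ha).ne_one
      change aeval w p ∈ _
      rw [← aeval_modByMonic_eq_self_of_root (minpoly.aeval F w),
        aeval_eq_sum_range' (natDegree_modByMonic_lt p hmonic hne)]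
      refine Submodule.sum_mem _ fun i hi => Submodule.smul_mem _ _ (Submodule.subset_span ?_)
      exact ⟨⟨i, Finset.mem_range.1 hi⟩, rfl⟩
    · rintro _ ⟨i, rfl⟩
      exact pow_mem (Algebra.self_mem_adjoin_singleton F w) _
  rw [h1, finrank_span_eq_card (linearIndependent_pow w), Fintype.card_fin, h.minpoly_eq ha,
    natDegree_X_pow_sub_C]

theorem finrank_map_adjoin : Module.finrank F
    ((Subalgebra.toSubmodule (Algebra.adjoin F {w})).map (LinearMap.mulRight F z)) = 5 := by
  rw [← h.finrank_adjoin ha]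
  exact (Submodule.equivMapOfInjective _ (h.isUnit_right.mul_left_injective) _).finrank_eq.symm

theorem finrank_adjoinMulAddSpan (i : ℕ) :
    Module.finrank F (adjoinMulAddSpan F w z (w ^ i)) = 6 := by
  have hM := h.finrank_map_adjoin ha
  have : Module.Finite F
    ((Subalgebra.toSubmodule (Algebra.adjoin F {w})).map (LinearMap.mulRight F z)) :=
    Module.finite_of_finrank_pos (by omega)
  have h1 := Submodule.finrank_sup_add_finrank_inf_eq
    ((Subalgebra.toSubmodule (Algebra.adjoin F {w})).map (LinearMap.mulRight F z))
    (Submodule.span F {w ^ i})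
  have hne : w ^ i ≠ 0 := (h.isUnit_left.pow i).ne_zero
  -- Conjugation by `w` scales `F[w] z` by `q⁻¹` and fixes `w ^ i`, so the two meet trivially.
  have h2 : (Subalgebra.toSubmodule (Algebra.adjoin F {w})).map (LinearMap.mulRight F z) ⊓
      Submodule.span F {w ^ i} = ⊥ := by
    rw [eq_bot_iff]
    rintro v ⟨hv1, hv2⟩
    obtain ⟨c, rfl⟩ := Submodule.mem_span_singleton.1 hv2
    obtain ⟨r, hr, hv⟩ := hv1
    rw [SetLike.mem_coe, Subalgebra.mem_toSubmodule,
      Algebra.adjoin_singleton_eq_range_aeval] at hr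
    obtain ⟨p, rfl⟩ := hr
    have hv : aeval w p * z = c • w ^ i := hv
    have h3 := (h.semiconj_left 1 p 0).eq
    have h4 : w ^ 1 * (c • w ^ i) = c • w ^ i * w ^ 1 := by
      rw [mul_smul_comm, smul_mul_assoc, ← pow_add, ← pow_add, add_comm]
    rw [map_zero, add_zero, add_zero, hv, h4, (h.isUnit_left.pow 1).mul_left_inj, pow_one] at h3
    have h5 : (1 - q⁻¹) • (c • w ^ i) = 0 := by rw [sub_smul, one_smul, ← h3, sub_self]
    have h6 : (1 - q⁻¹ : F) ≠ 0 := sub_ne_zero.2 (h.prim.inv.ne_one (by norm_num)).symm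
    exact (smul_eq_zero.1 h5).resolve_left h6
  rw [h2, finrank_bot, finrank_span_singleton hne, hM] at h1
  rw [adjoinMulAddSpan]
  omega

end Domain

/-- A large `5`-central subspace of `F[w] z + F w ^ i` forces `w ^ 5` not to be a fifth power. -/
theorem pow_ne_of_le [FiniteDimensional F A] {V : Submodule F A} (hV : IsDCentralSpace 5 V)
    (hdim : 4 ≤ Module.finrank F V) {u : A} (hle : V ≤ adjoinMulAddSpan F w z u) (c : F) :
    c ^ 5 ≠ a := by
  set M := (Subalgebra.toSubmodule (Algebra.adjoin F {w})).map (LinearMap.mulRight F z) with hM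
  have h1 := Submodule.finrank_sup_add_finrank_inf_eq V M
  have h2 : Module.finrank F ↥(V ⊔ M) ≤ Module.finrank F M + 1 := by
    have h3 : V ⊔ M ≤ M ⊔ Submodule.span F {u} := sup_le hle le_sup_left
    have h4 := Submodule.finrank_mono h3
    have h5 := Submodule.finrank_add_le_finrank_add_finrank M (Submodule.span F {u})
    have h6 := finrank_span_le_card (R := F) ({u} : Set A)
    simp only [Set.toFinset_singleton, Finset.card_singleton] at h6
    omega
  obtain ⟨f, hf⟩ := exists_linearIndependent_of_le_finrank
    -- `M` has codimension at most one in the standard space, so `V` loses at most one dimension on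
    -- intersecting with it.
    (show 3 ≤ Module.finrank F ↥(V ⊓ M) by omega)
  refine h.pow_ne_of_linearIndependent hV (fun i => (f i : A))
    (hf.map' (V ⊓ M).subtype (Submodule.ker_subtype _)) (fun i => (f i).2.1) (fun i => ?_) c
  obtain ⟨r, hr, hv⟩ := (f i).2.2
  rw [SetLike.mem_coe, Subalgebra.mem_toSubmodule, Algebra.adjoin_singleton_eq_range_aeval] at hr
  obtain ⟨p, rfl⟩ := hr
  exact ⟨p, hv.symm⟩

/-- The maximal `5`-central spaces contained in a standard one have dimension six. -/
theorem finrank_eq_six_of_maximal [FiniteDimensional F A] [Nontrivial A] {V : Submodule F A}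
    (hV : Maximal (fun W : Submodule F A => IsDCentralSpace 5 W) V)
    (hdim : 4 ≤ Module.finrank F V) {i : ℕ} (hi : ¬ 5 ∣ i)
    (hle : V ≤ adjoinMulAddSpan F w z (w ^ i)) : Module.finrank F V = 6 := by
  have ha := h.pow_ne_of_le hV.1 hdim hle
  rw [← h.finrank_adjoinMulAddSpan ha i,
    le_antisymm hle (hV.2 (h.isDCentralSpace ha hi) hle)]

end SymbolPair

/-! ### The standard spaces in terms of monomials -/

namespace SymbolAlgebra

variable {F : Type*} [Field F] {ρ : F} (hρ : IsPrimitiveRoot ρ 5) {α β : F} (hα : α ≠ 0)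
  (hβ : β ≠ 0)

theorem finiteDimensional (hρ : ρ ^ 5 = 1) (hα : α ≠ 0) (hβ : β ≠ 0) :
    FiniteDimensional F (SymbolAlgebra 5 ρ α β) :=
  FiniteDimensional.of_injective (coord hρ α β) (coord_injective hρ hα hβ)

theorem mono_eq_inv_smul {ρ α β : F} {c : F} (hc : c ≠ 0) {u : SymbolAlgebra 5 ρ α β} {n : Fin 5 × Fin 5}
    (h : u = c • mono ρ α β n) : mono ρ α β n = c⁻¹ • u := by
  rw [h, smul_smul, inv_mul_cancel₀ hc, one_smul]

theorem mono_mem_of_family_zero {ρ α β : F} {n : Fin 5 × Fin 5} (hn : family 0 n = true) :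
    mono ρ α β n ∈ adjoinMulAddSpan F (x 5 ρ α β) (y 5 ρ α β) (x 5 ρ α β) := by
  simp only [family, Fin.val_zero, Bool.or_eq_true, beq_iff_eq] at hn
  rcases hn with hn | rfl
  · have := mem_adjoinMulAddSpan (x 5 ρ α β) (y 5 ρ α β) (x 5 ρ α β) (X ^ (n.1 : ℕ) : F[X]) 0
    simpa [mono, hn] using this
  · have := mem_adjoinMulAddSpan (x 5 ρ α β) (y 5 ρ α β) (x 5 ρ α β) (0 : F[X]) 1
    simpa [mono] using this

include hρ

theorem mono_mem_of_family_one {n : Fin 5 × Fin 5} (hn : family 1 n = true) :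
    mono ρ α β n ∈ adjoinMulAddSpan F (y 5 ρ α β) (x 5 ρ α β) (y 5 ρ α β) := by
  simp only [family, Fin.val_one, Bool.or_eq_true, beq_iff_eq] at hn
  rcases hn with hn | rfl
  · have h1 := mem_adjoinMulAddSpan (y 5 ρ α β) (x 5 ρ α β) (y 5 ρ α β) (X ^ (n.2 : ℕ) : F[X]) 0
    have h2 := qcomm_pow_pow (y_mul_x (d := 5) (ρ := ρ) (α := α) (β := β)) 1 n.2
    rw [pow_one] at h2
    rw [zero_smul, add_zero, map_pow, aeval_X, h2] at h1
    have h0 := pow_ne_zero ((n.2 : ℕ) * 1) (hρ.ne_zero (by norm_num))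
    have h3 := Submodule.smul_mem _ (ρ ^ ((n.2 : ℕ) * 1))⁻¹ h1
    rw [smul_smul, inv_mul_cancel₀ h0, one_smul] at h3
    simpa [mono, hn] using h3
  · have := mem_adjoinMulAddSpan (y 5 ρ α β) (x 5 ρ α β) (y 5 ρ α β) (0 : F[X]) 1
    simpa [mono] using this

include hα hβ

theorem symbolPair_x_y : SymbolPair ρ α β (x 5 ρ α β) (y 5 ρ α β) where
  prim := hρ
  left_ne := hα
  right_ne := hβ
  left_pow := x_pow_self
  right_pow := y_pow_self
  mul_comm := y_mul_x
  mem_center _ := mem_center_of_commute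

theorem symbolPair_y_x : SymbolPair ρ⁻¹ β α (y 5 ρ α β) (x 5 ρ α β) where
  prim := hρ.inv
  left_ne := hβ
  right_ne := hα
  left_pow := y_pow_self
  right_pow := x_pow_self
  mul_comm := by
    rw [y_mul_x, smul_smul, inv_mul_cancel₀ (hρ.ne_zero (by norm_num)), one_smul]
  mem_center _ h1 h2 := mem_center_of_commute h2 h1

/-- The scalar relating `(x ^ 3 y ^ 2) ^ k x ^ e` to a monomial. -/
theorem exists_smul_mono_eq (k e : ℕ) :
    ∃ c : F, c ≠ 0 ∧ (x 5 ρ α β ^ 3 * y 5 ρ α β ^ 2) ^ k * x 5 ρ α β ^ e =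
      c • mono ρ α β (Fin.ofNat 5 (3 * k + e), Fin.ofNat 5 (2 * k)) := by
  obtain ⟨s, hs⟩ := qcomm_monomial_pow (y_mul_x (d := 5) (ρ := ρ) (α := α) (β := β)) 3 2 k
  obtain ⟨c, hc, h⟩ := monomial_eq_smul (ρ := ρ) hα hβ (3 * k + e) (2 * k)
  have h1 := qcomm_monomial_mul (y_mul_x (d := 5) (ρ := ρ) (α := α) (β := β)) (3 * k) (2 * k) e 0
  rw [pow_zero, mul_one, add_zero, h] at h1
  have h0 := hρ.ne_zero (by norm_num)
  refine ⟨ρ ^ s * (ρ ^ (2 * k * e) * c), by positivity, ?_⟩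
  rw [hs, smul_mul_assoc, h1, smul_smul, smul_smul, mul_assoc]

theorem symbolPair_w_x : ∃ a, SymbolPair (ρ⁻¹ ^ 2) a α (x 5 ρ α β ^ 3 * y 5 ρ α β ^ 2)
    (x 5 ρ α β) := by
  obtain ⟨c, hc, h⟩ := exists_smul_mono_eq hρ hα hβ 5 0
  have h0 := hρ.ne_zero (by norm_num)
  have hxy := symbolPair_x_y hρ hα hβ
  refine ⟨c, ?_, hc, hα, ?_, x_pow_self, ?_, ?_⟩
  · exact hρ.inv.pow_of_coprime 2 (by norm_num)
  · rw [pow_zero, mul_one] at h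
    rw [h, Algebra.algebraMap_eq_smul_one]
    congr 1
    simp [mono]
  · have h1 := qcomm_monomial_mul (y_mul_x (d := 5) (ρ := ρ) (α := α) (β := β)) 3 2 1 0
    simp only [pow_one, pow_zero, mul_one, add_zero] at h1
    rw [h1, smul_smul, ← mul_pow, inv_mul_cancel₀ h0, one_pow, one_smul, ← mul_assoc, ← pow_succ']
  · intro u hw hx
    refine mem_center_of_commute hx ?_
    have h1 : Commute (y 5 ρ α β ^ 2) u := by
      have h2 : x 5 ρ α β ^ 3 * (y 5 ρ α β ^ 2 * u) = x 5 ρ α β ^ 3 * (u * y 5 ρ α β ^ 2) := by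
        rw [← mul_assoc, hw.eq, ← mul_assoc, ← mul_assoc, (hx.pow_left 3).eq]
      exact (hxy.isUnit_left.pow 3).mul_right_inj.1 h2
    -- `y ^ 6 = β y` recovers `y` from `y ^ 2`.
    have h3 : Commute (y 5 ρ α β ^ 6) u := by
      have := h1.pow_left 3
      rwa [← pow_mul] at this
    rw [pow_succ, y_pow_self, ← Algebra.smul_def] at h3
    simpa [smul_smul, inv_mul_cancel₀ hβ] using h3.smul_left β⁻¹

/-- Up to a scalar, `w ^ k x` has degree `(3 k + 1, 2 k)`, and `3` is the inverse of `2` modulo `5`,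
whence `k = 3 * n.2`. -/
theorem mono_eq_aeval_mul {n : Fin 5 × Fin 5} (hn : n.1 + n.2 = 1) :
    ∃ p : F[X], mono ρ α β n = aeval (x 5 ρ α β ^ 3 * y 5 ρ α β ^ 2) p * x 5 ρ α β := by
  obtain ⟨c, hc, h⟩ := exists_smul_mono_eq hρ hα hβ (3 * n.2) 1
  have h1 : ∀ n : Fin 5 × Fin 5, n.1 + n.2 = 1 →
      (Fin.ofNat 5 (3 * (3 * n.2) + 1), Fin.ofNat 5 (2 * (3 * n.2))) = n := by decide
  rw [h1 n hn] at h
  refine ⟨C c⁻¹ * X ^ (3 * (n.2 : ℕ)), ?_⟩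
  rw [mono_eq_inv_smul hc h]
  simp [Algebra.smul_def, mul_assoc]

theorem mono_eq_smul_pow (i : ℕ) : ∃ c : F, c ≠ 0 ∧
    mono ρ α β (Fin.ofNat 5 (3 * i), Fin.ofNat 5 (2 * i)) =
      c • (x 5 ρ α β ^ 3 * y 5 ρ α β ^ 2) ^ i := by
  obtain ⟨c, hc, h⟩ := exists_smul_mono_eq hρ hα hβ i 0
  rw [pow_zero, mul_one, add_zero] at h
  exact ⟨c⁻¹, inv_ne_zero hc, mono_eq_inv_smul hc h⟩

theorem le_of_coord_ne_zero {V W : Submodule F (SymbolAlgebra 5 ρ α β)}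
    (h : ∀ v ∈ V, ∀ n, coord hρ.pow_eq_one α β v n ≠ 0 → mono ρ α β n ∈ W) : V ≤ W := by
  intro v hv
  rw [← sum_coord hρ.pow_eq_one hα hβ v]
  refine W.sum_mem fun n _ => ?_
  by_cases h0 : coord hρ.pow_eq_one α β v n = 0
  · simp [h0]
  · exact W.smul_mem _ (h v hv n h0)

/-- The case where the third monomial lies in `F[x ^ 3 y ^ 2] x`. -/
theorem exists_le_of_sum_eq_one {V : Submodule F (SymbolAlgebra 5 ρ α β)}
    (hV : IsDCentralSpace 5 V) (u : Fin 3 → Fin 5 × Fin 5) (hu : Function.Injective u)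
    (huV : ∀ k, mono ρ α β (u k) ∈ V) (hu1 : ∀ k, (u k).1 + (u k).2 = 1)
    (hsupp : ∀ v ∈ V, ∀ n, coord hρ.pow_eq_one α β v n ≠ 0 → family 6 n = true) :
    ∃ i : ℕ, 1 ≤ i ∧ i ≤ 4 ∧ V ≤ adjoinMulAddSpan F (x 5 ρ α β ^ 3 * y 5 ρ α β ^ 2)
      (x 5 ρ α β) ((x 5 ρ α β ^ 3 * y 5 ρ α β ^ 2) ^ i) := by
  classical
  obtain ⟨a, hpair⟩ := symbolPair_w_x hρ hα hβ
  have hlin : LinearIndependent F fun k => mono ρ α β (u k) := by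
    refine LinearIndependent.of_comp (coord hρ.pow_eq_one α β) ?_
    have : (coord hρ.pow_eq_one α β ∘ fun k => mono ρ α β (u k)) =
        (fun n : Fin 5 × Fin 5 => Pi.single n (1 : F)) ∘ u := by
      funext k
      exact coord_mono _ _ _ _
    rw [this]
    exact (Pi.linearIndependent_single_one (Fin 5 × Fin 5) F).comp u hu
  -- The three given monomials lie in `F[w] x`, so `F[w]` is a field; this is what separates the
  -- powers of `w`.
  have ha := hpair.pow_ne_of_linearIndependent hV _ hlin huV
    fun k => mono_eq_aeval_mul hρ hα hβ (hu1 k)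
  have : Nontrivial (SymbolAlgebra 5 ρ α β) := ⟨_, _, hlin.ne_zero 0⟩
  choose c hc0 hc using mono_eq_smul_pow hρ hα hβ
  set E : ℕ → Fin 5 × Fin 5 := fun i => (Fin.ofNat 5 (3 * i), Fin.ofNat 5 (2 * i)) with hE
  have hdec : ∀ v ∈ V, ∃ p : F[X], v = aeval (x 5 ρ α β ^ 3 * y 5 ρ α β ^ 2) p * x 5 ρ α β +
      aeval (x 5 ρ α β ^ 3 * y 5 ρ α β ^ 2) (∑ i ∈ Finset.Icc 1 4,
        C (coord hρ.pow_eq_one α β v (E i) * c i) * X ^ i) := by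
    intro v hv
    have h1 : ∀ n : Fin 5 × Fin 5, n.1 + n.2 = 1 → ∃ p : F[X], mono ρ α β n =
        aeval (x 5 ρ α β ^ 3 * y 5 ρ α β ^ 2) p * x 5 ρ α β := fun n hn =>
      mono_eq_aeval_mul hρ hα hβ hn
    choose! P hP using h1
    refine ⟨∑ n with n.1 + n.2 = 1, C (coord hρ.pow_eq_one α β v n) * P n, ?_⟩
    have h2 : ∑ n with n.1 + n.2 ≠ 1, coord hρ.pow_eq_one α β v n • mono ρ α β n =
        ∑ i ∈ Finset.Icc 1 4, coord hρ.pow_eq_one α β v (E i) • mono ρ α β (E i) := by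
      have h3 : Set.InjOn E (Finset.Icc 1 4 : Finset ℕ) := by
        intro i hi j hj hij
        simp only [Finset.coe_Icc, Set.mem_Icc] at hi hj
        obtain ⟨hi1, hi4⟩ := hi
        obtain ⟨hj1, hj4⟩ := hj
        interval_cases i <;> interval_cases j <;> first | rfl | (revert hij; decide)
      rw [← Finset.sum_image (f := fun n => coord hρ.pow_eq_one α β v n • mono ρ α β n) h3]
      symm
      refine Finset.sum_subset ?_ ?_
      · decide
      · intro n hn hn'
        by_cases h0 : coord hρ.pow_eq_one α β v n = 0
        · simp [h0]
        exfalso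
        have h4 := hsupp v hv n h0
        clear h0
        revert h4 hn' hn
        revert n
        decide
    conv_lhs => rw [← sum_coord hρ.pow_eq_one hα hβ v]
    rw [← Finset.sum_filter_add_sum_filter_not _ (fun n => n.1 + n.2 = 1), h2]
    congr 1
    · rw [map_sum, Finset.sum_mul]
      refine Finset.sum_congr rfl fun n hn => ?_
      rw [hP n (Finset.mem_filter.1 hn).2]
      simp [Algebra.smul_def, mul_assoc]
    · rw [map_sum]
      refine Finset.sum_congr rfl fun i _ => ?_
      rw [hc i]
      simp [Algebra.smul_def, mul_assoc]
  have hpairs : ∀ i ∈ Finset.Icc 1 4, ∀ j ∈ Finset.Icc 1 4, i ≠ j → ∀ v ∈ V,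
      coordForm hρ.pow_eq_one α β (E i) v * coordForm hρ.pow_eq_one α β (E j) v = 0 := by
    intro i hi j hj hij v hv
    obtain ⟨p, hp⟩ := hdec v hv
    have hcoeff : ∀ i ∈ Finset.Icc 1 4, (∑ i ∈ Finset.Icc 1 4,
        C (coord hρ.pow_eq_one α β v (E i) * c i) * X ^ i).coeff i =
          coord hρ.pow_eq_one α β v (E i) * c i := by
      intro i hi
      rw [finsetSum_coeff]
      simp only [coeff_C_mul_X_pow]
      rw [Finset.sum_ite_eq, if_pos hi]
    by_cases hv0 : v = 0
    · simp [hv0]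
    have hcen := (hV v hv hv0).2.1
    rw [hp] at hcen
    obtain ⟨k, hk⟩ := hpair.exists_coeff_eq_zero ha (lt_of_le_of_lt
      (natDegree_sum_le_of_forall_le (n := 4) _ _ fun i hi =>
        (natDegree_C_mul_X_pow_le _ _).trans (Finset.mem_Icc.1 hi).2) (by norm_num)) hcen
    have hz : ∀ i ∈ Finset.Icc 1 4, i ≠ k → coordForm hρ.pow_eq_one α β (E i) v = 0 := by
      intro i hi hik
      have h5 := hk i (by have := Finset.mem_Icc.1 hi; omega) hik
      rw [hcoeff i hi] at h5
      exact (mul_eq_zero.1 h5).resolve_right (hc0 i)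
    by_cases hik : i = k
    · rw [hz j hj (fun h => hij (hik.trans h.symm)), mul_zero]
    · rw [hz i hi hik, zero_mul]
  obtain ⟨k, hk, hkV⟩ : ∃ k ∈ Finset.Icc 1 4, ∀ i ∈ Finset.Icc 1 4, i ≠ k → ∀ v ∈ V,
      coord hρ.pow_eq_one α β v (E i) = 0 := by
    by_cases hex : ∃ k ∈ Finset.Icc 1 4, ∃ v ∈ V, coord hρ.pow_eq_one α β v (E k) ≠ 0
    · obtain ⟨k, hk, v, hv, h0⟩ := hex
      refine ⟨k, hk, fun i hi hik w hw => ?_⟩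
      rcases V.forall_eq_zero_or_of_mul_eq_zero _ _ (hpairs i hi k hk hik) with h | h
      · exact h w hw
      · exact absurd (h v hv) h0
    -- No power of `w` occurs in `V`, so any exponent will do.
    · push Not at hex
      exact ⟨1, by simp, fun i hi _ w hw => hex i hi w hw⟩
  refine ⟨k, (Finset.mem_Icc.1 hk).1, (Finset.mem_Icc.1 hk).2, fun v hv => ?_⟩
  obtain ⟨p, hp⟩ := hdec v hv
  rw [Finset.sum_eq_single k (fun i hi hik => by simp [hkV i hi hik v hv])
    (fun h => absurd hk h)] at hp
  rw [hp]
  have := mem_adjoinMulAddSpan (x 5 ρ α β ^ 3 * y 5 ρ α β ^ 2) (x 5 ρ α β)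
    ((x 5 ρ α β ^ 3 * y 5 ρ α β ^ 2) ^ k) p (coord hρ.pow_eq_one α β v (E k) * c k)
  simpa [Algebra.smul_def] using this

theorem le_of_family {V : Submodule F (SymbolAlgebra 5 ρ α β)} {t : Fin 7} (h2 : 2 ≤ t)
    (h5 : t ≤ 5) (hsupp : ∀ v ∈ V, ∀ n, coord hρ.pow_eq_one α β v n ≠ 0 → family t n = true) :
    V ≤ adjoinMulAddSpan F (x 5 ρ α β ^ 3 * y 5 ρ α β ^ 2)
      (x 5 ρ α β) ((x 5 ρ α β ^ 3 * y 5 ρ α β ^ 2) ^ ((t : ℕ) - 1)) := by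
  have hfam : ∀ t : Fin 7, 2 ≤ t → t ≤ 5 → ∀ n, family t n = true → n.1 + n.2 = 1 ∨
      n = (Fin.ofNat 5 (3 * (t - 1)), Fin.ofNat 5 (2 * (t - 1))) := by decide
  refine le_of_coord_ne_zero hρ hα hβ fun v hv n hn => ?_
  rcases hfam t h2 h5 n (hsupp v hv n hn) with h | h
  · obtain ⟨p, hp⟩ := mono_eq_aeval_mul hρ hα hβ h
    rw [hp]
    simpa using mem_adjoinMulAddSpan (x 5 ρ α β ^ 3 * y 5 ρ α β ^ 2) (x 5 ρ α β)
      ((x 5 ρ α β ^ 3 * y 5 ρ α β ^ 2) ^ ((t : ℕ) - 1)) p 0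
  · obtain ⟨c, -, hc⟩ := mono_eq_smul_pow hρ hα hβ ((t : ℕ) - 1)
    rw [h, hc]
    simpa using mem_adjoinMulAddSpan (x 5 ρ α β ^ 3 * y 5 ρ α β ^ 2) (x 5 ρ α β)
      ((x 5 ρ α β ^ 3 * y 5 ρ α β ^ 2) ^ ((t : ℕ) - 1)) 0 c

theorem le_standard [Infinite F] {V : Submodule F (SymbolAlgebra 5 ρ α β)}
    (hV : IsDCentralSpace 5 V) (hdim : 4 ≤ Module.finrank F V) (hx : x 5 ρ α β ∈ V)
    (hy : y 5 ρ α β ∈ V) {i j : ℕ}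
    (hij : LinearIndependent F ![x 5 ρ α β, y 5 ρ α β, x 5 ρ α β ^ i * y 5 ρ α β ^ j])
    (hm : x 5 ρ α β ^ i * y 5 ρ α β ^ j ∈ V) :
    V ≤ adjoinMulAddSpan F (x 5 ρ α β) (y 5 ρ α β) (x 5 ρ α β) ∨
      V ≤ adjoinMulAddSpan F (y 5 ρ α β) (x 5 ρ α β) (y 5 ρ α β) ∨
      ∃ i : ℕ, 1 ≤ i ∧ i ≤ 4 ∧ V ≤ adjoinMulAddSpan F (x 5 ρ α β ^ 3 * y 5 ρ α β ^ 2)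
        (x 5 ρ α β) ((x 5 ρ α β ^ 3 * y 5 ρ α β ^ 2) ^ i) := by
  obtain ⟨c, hc, h⟩ := monomial_eq_smul (ρ := ρ) hα hβ i j
  set m : Fin 5 × Fin 5 := (Fin.ofNat 5 i, Fin.ofNat 5 j)
  have hx' : mono ρ α β (1, 0) = x 5 ρ α β := by simp [mono]
  have hy' : mono ρ α β (0, 1) = y 5 ρ α β := by simp [mono]
  have hmx : m ≠ (1, 0) := by
    intro h0
    rw [h, h0, hx'] at hij
    have := Fintype.linearIndependent_iff.1 hij ![c, 0, -1] (by simp [Fin.sum_univ_succ]) 2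
    simp at this
  have hmy : m ≠ (0, 1) := by
    intro h0
    rw [h, h0, hy'] at hij
    have := Fintype.linearIndependent_iff.1 hij ![0, c, -1] (by simp [Fin.sum_univ_succ]) 2
    simp at this
  have hmV : mono ρ α β m ∈ V := by
    rw [mono_eq_inv_smul hc h]
    exact V.smul_mem _ hm
  rw [← hx'] at hx
  rw [← hy'] at hy
  obtain ⟨t, -, -, -, ht, hsupp⟩ := exists_family hρ hα hβ hV hmx hmy hx hy hmV hdim
  have hcases : ∀ t : Fin 7, t = 0 ∨ t = 1 ∨ t = 6 ∨ (2 ≤ t ∧ t ≤ 5) := by decide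
  rcases hcases t with rfl | rfl | rfl | ⟨h2, h5⟩
  · exact Or.inl (le_of_coord_ne_zero hρ hα hβ fun v hv n hn =>
      mono_mem_of_family_zero (hsupp v hv n hn))
  · exact Or.inr (Or.inl (le_of_coord_ne_zero hρ hα hβ fun v hv n hn =>
      mono_mem_of_family_one hρ (hsupp v hv n hn)))
  · refine Or.inr (Or.inr (exists_le_of_sum_eq_one hρ hα hβ hV ![(1, 0), (0, 1), m] ?_ ?_ ?_ hsupp))
    · intro k l hkl
      fin_cases k <;> fin_cases l <;> simp_all
    · intro k
      fin_cases k <;> assumption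
    · intro k
      fin_cases k
      · rfl
      · rfl
      · exact ht rfl
  · refine Or.inr (Or.inr ⟨(t : ℕ) - 1, ?_, ?_, le_of_family hρ hα hβ h2 h5 hsupp⟩)
    · have : 2 ≤ (t : ℕ) := h2
      omega
    · have : (t : ℕ) ≤ 5 := h5
      omega

end SymbolAlgebra

end

theorem mainTheorem11 {F : Type*} [Field F] [Infinite F] (ρ : F) (hρ : IsPrimitiveRoot ρ 5)
    (α β : F) (hα : α ≠ 0) (hβ : β ≠ 0)
    (x y : SymbolAlgebra 5 ρ α β)
    (hx : x = SymbolAlgebra.x 5 ρ α β) (hy : y = SymbolAlgebra.y 5 ρ α β)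
    (V : Submodule F (SymbolAlgebra 5 ρ α β))
    (hV : IsDCentralSpace 5 V) (hdim : 4 ≤ Module.finrank F V)
    (hxV : x ∈ V) (hyV : y ∈ V)
    (hij : ∃ i j : ℕ, LinearIndependent F ![x, y, x ^ i * y ^ j] ∧ x ^ i * y ^ j ∈ V) :
    (V ≤ adjoinMulAddSpan F x y x ∨
      V ≤ adjoinMulAddSpan F y x y ∨
      ∃ i : ℕ, 1 ≤ i ∧ i ≤ 4 ∧
        V ≤ adjoinMulAddSpan F (x ^ 3 * y ^ 2) x ((x ^ 3 * y ^ 2) ^ i)) ∧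
    (Maximal (fun W : Submodule F (SymbolAlgebra 5 ρ α β) => IsDCentralSpace 5 W) V →
      Module.finrank F V = 6) := by
  subst hx hy
  obtain ⟨i, j, hind, hmem⟩ := hij
  have hle := SymbolAlgebra.le_standard hρ hα hβ hV hdim hxV hyV hind hmem
  refine ⟨hle, fun hmax => ?_⟩
  have := SymbolAlgebra.finiteDimensional hρ.pow_eq_one hα hβ
  have : Nontrivial (SymbolAlgebra 5 ρ α β) := ⟨_, _, hind.ne_zero 0⟩
  rcases hle with h | h | ⟨k, h1, h4, h⟩
  · exact (SymbolAlgebra.symbolPair_x_y hρ hα hβ).finrank_eq_six_of_maximal hmax hdim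
      (i := 1) (by norm_num) (by simpa using h)
  · exact (SymbolAlgebra.symbolPair_y_x hρ hα hβ).finrank_eq_six_of_maximal hmax hdim
      (i := 1) (by norm_num) (by simpa using h)
  · obtain ⟨a, hp⟩ := SymbolAlgebra.symbolPair_w_x hρ hα hβ
    exact hp.finrank_eq_six_of_maximal hmax hdim (by omega) h
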